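/- Let $D=(V,A)$ be a finite directed graph (parallel arcs allowed) with arc capacities $c\in\mathbb{R}_{\ge 0}^A$, and let $b\colon V\to\mathbb{R}$ satisfy $\sum_{v\in V}b(v)=0$. A vertex $v$ is a source if $b(v)>0$ and a sink if $b(v)<0$. For a function $\beta\colon V\to\mathbb{R}$, a $\beta$-transshipment is a flow $x\in\mathbb{R}^A_{\ge 0}$ with $\sum_{a\in\delta^{\mathrm{out}}(v)}x_a-\sum_{a\in\delta^{\mathrm{in}}(v)}x_a=\beta(v)$ for all $v\in V$. It is feasible if $x_a\le c_a$ for all $a\in A$. It is unsplittable if it comes with a decomposition into flows along directed paths, each leading from a vertex $s$ with $\beta(s)>0$ to a vertex $t$ with $\beta(t)<0$, with at most one path for each pair $(s,t)$. Let $d_{\max}=\max\{|b(t)| : t\text{ a sink}\}$ and $c_{\min}=\min_{a\in A}c_a$ (each read as $0$ if there is no sink, respectively no arc). Assume that a feasible $b$-transshipment exists and that $d_{\max}\le(1-\frac1n)\,c_{\min}$ for an integer $n\ge 1$. Then all demands can be routed unsplittably in at most $(n+1)(N_{\mathrm{tot}}+1)$ rounds, where $$N_{\mathrm{tot}}=\sum_{j=0}^{n}\binom{(n^2-1)(n+1)-j+n}{n}.$$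 That is, with $K=(n+1)(N_{\mathrm{tot}}+1)$, there are a partition of the set of sinks into sets $T_1,\dots,T_K$ (some possibly empty), functions $\beta_1,\dots,\beta_K\colon V\to\mathbb{R}$, and for each $i$ a feasible unsplittable $\beta_i$-transshipment, such that for each $i$: $\beta_i(t)=b(t)$ for $t\in T_i$, $\beta_i(t)=0$ for every sink $t\notin T_i$, $\beta_i(v)=0$ for every $v$ with $b(v)=0$, and $\beta_i(s)\ge 0$ for every source $s$; and such that $\sum_{i=1}^K\beta_i(s)=b(s)$ for every source $s$. -/

import Mathlib

open Finset

noncomputable section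

/-- A directed graph with vertex set `V` and arc set `A` (parallel arcs are allowed): every arc `a`
leads from `tail a` to `head a`. -/
structure ArcDigraph (V A : Type*) where
  tail : A → V
  head : A → V

namespace ArcDigraph

variable {V A : Type*}

/-- `D.IsWalk u v l`: the list of arcs `l` is a directed walk from `u` to `v`. -/
def IsWalk (D : ArcDigraph V A) : V → V → List A → Prop
  | u, v, [] => u = v
  | u, v, a :: l => D.tail a = u ∧ D.IsWalk (D.head a) v l

/-- `D.IsPath u v l`: the list of arcs `l` is a directed path from `u` to `v`, that is, a directed
walk that visits no vertex twice. -/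
def IsPath (D : ArcDigraph V A) (u v : V) (l : List A) : Prop :=
  D.IsWalk u v l ∧ (u :: l.map D.head).Nodup

open Classical in
/-- `x` is a `b`-transshipment: a nonnegative arc flow whose net outflow at each `v` is `b v`. -/
def IsTransshipment [Fintype A] (D : ArcDigraph V A) (b : V → ℝ) (x : A → ℝ) : Prop :=
  (∀ a, 0 ≤ x a) ∧
    ∀ v, (∑ a with D.tail a = v, x a) - (∑ a with D.head a = v, x a) = b v

open Classical in
/-- `y` is (the arc flow of) an unsplittable `b`-transshipment: it is a `b`-transshipment with a
decomposition into source-sink paths that has at most one path for each pair of a source `s` and a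
sink `t`, namely `P s t`, which carries the amount `f s t` of flow. The path `P s t` is not in use,
and arbitrary, if `f s t = 0`. -/
def IsUnsplittableTransshipment [Fintype V] [Fintype A] (D : ArcDigraph V A)
    (b : V → ℝ) (y : A → ℝ) : Prop :=
  D.IsTransshipment b y ∧
    ∃ (P : V → V → List A) (f : V → V → ℝ),
      (∀ s t, 0 ≤ f s t) ∧
      (∀ s t, f s t ≠ 0 → 0 < b s ∧ b t < 0 ∧ D.IsPath s t (P s t)) ∧
      (∀ a, y a = ∑ s, ∑ t, if a ∈ P s t then f s t else 0)

/-- The demands of all sinks of the balance function `b` can be routed unsplittably in (at most) `K`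
rounds with respect to the arc capacities `c`. The sets `T i` partition the set of sinks (some may
be empty). In round `i` an unsplittable transshipment `y i` that respects the capacities satisfies
the full demand of the sinks in `T i` and of no other sink; `β i` is its balance function, so
`β i s` is the amount that the source `s` sends in round `i`. Over all rounds each source sends
exactly its supply. -/
def RoutableInRounds [Fintype V] [Fintype A] (D : ArcDigraph V A)
    (b : V → ℝ) (c : A → ℝ) (K : ℕ) : Prop :=
  ∃ (T : Fin K → Set V) (β : Fin K → V → ℝ) (y : Fin K → A → ℝ),
    (∀ i, T i ⊆ {v | b v < 0}) ∧
    (∀ v, b v < 0 → ∃! i, v ∈ T i) ∧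
    (∀ i, ∀ v ∈ T i, β i v = b v) ∧
    (∀ i v, b v < 0 → v ∉ T i → β i v = 0) ∧
    (∀ i v, b v = 0 → β i v = 0) ∧
    (∀ i v, 0 < b v → 0 ≤ β i v) ∧
    (∀ v, 0 < b v → ∑ i, β i v = b v) ∧
    (∀ i, D.IsUnsplittableTransshipment (β i) (y i)) ∧
    (∀ i a, y i a ≤ c a)

end ArcDigraph

/-- The maximum demand `max {|b t| : t a sink}` (and `0` if there are no sinks). -/
def maxDemand {V : Type*} (b : V → ℝ) : ℝ := ⨆ t : {v : V // b v < 0}, |b t|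

/-- The minimum arc capacity (and `0` if there are no arcs). -/
def minCapacity {A : Type*} (c : A → ℝ) : ℝ := ⨅ a, c a

/-- `∑_{j=0}^{n} binom((n² - 1)(n + 1) - j + n, n)`; no subtraction truncates for `1 ≤ n`. -/
def groupCount (n : ℕ) : ℕ :=
  ∑ j ∈ Finset.range (n + 1), Nat.choose ((n ^ 2 - 1) * (n + 1) + n - j) n

end

/-! After flow on directed cycles has been cancelled, the support of `x` is acyclic. Take `n + 1`
copies (colours) of it, each carrying `x / (n + 1)`, and join the copies of every vertex to a common
entrance and a common exit. The core is a rounding theorem for this layered digraph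
(`IsState.routable`): all demands can be routed with one path per source-sink pair so that, if `g t
j` is the amount which `t` receives in copy `j`, then on every arc of copy `j` the flow to any set
of terminals is at most the fractional flow plus the largest `g t j` in the set. Moreover every
terminal `t` has a preferred copy `p t`, and each arc serves at most one terminal that does not
prefer its copy.

Given this, put two sinks into the same round only if they prefer the same copy and their
proportions `g t j / |b t|`, rounded down to multiples of `1 / M` with `M = (n² - 1)(n + 1)`, agree.
Within a round, an arc receives at most `x a / (n + 1)` plus one share in the preferred copy, and
one share in every other copy. The shares add up to at most `(1 + (n + 1) / M) * dmax`, which the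
bound on `dmax` turns into `n / (n + 1) * c a`. Counting the rounded vectors gives `groupCount n`.

The rounding theorem is proved by induction on the support. Terminals are moved backwards along arcs
that carry at least their demand (`Routable.of_move`). When this is no longer possible, the vertices
from which no branching vertex can be reached are declared to be `Z`; on arcs into `Z` the load is
bounded by one share alone, so that the flow there may be increased freely as long as it does not
pass the demands at the head. Now either some vertex where the flow ends has at most one entering
arc that comes from a branching vertex, and the tree behind its other arcs is routed separately
(`Routable.of_dead_tree`); or Hall's theorem gives a circulation that increases flow only on arcs
into `Z` (`exists_alternating_circulation`), and augmenting along it either empties an arc or makes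
an arc equal to a demand at its head, which allows another move. -/

noncomputable section

/-! ### Net outflow, walks, and cancelling cycles -/

namespace ArcDigraph

open scoped Classical

variable {V A : Type*}

/-- Net outflow of `x` at `v`. -/
def net [Fintype A] (D : ArcDigraph V A) (x : A → ℝ) (v : V) : ℝ :=
  (∑ a, if D.tail a = v then x a else 0) - ∑ a, if D.head a = v then x a else 0

theorem net_add [Fintype A] (D : ArcDigraph V A) (x y : A → ℝ) (v : V) :
    D.net (fun a => x a + y a) v = D.net x v + D.net y v := by
  have h : ∀ (q : A → V), (∑ a, if q a = v then x a + y a else 0)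
      = (∑ a, if q a = v then x a else 0) + ∑ a, if q a = v then y a else 0 := by
    intro q
    rw [← sum_add_distrib]
    refine sum_congr rfl fun a _ => ?_
    split_ifs <;> simp
  simp only [net, h]
  ring

theorem net_smul [Fintype A] (D : ArcDigraph V A) (r : ℝ) (x : A → ℝ) (v : V) :
    D.net (fun a => r * x a) v = r * D.net x v := by
  simp only [net, mul_sub, mul_sum, mul_ite, mul_zero]

theorem net_zero [Fintype A] (D : ArcDigraph V A) (v : V) : D.net (fun _ => 0) v = 0 := by
  simp [net]

theorem net_sum [Fintype A] {ι : Type*} (D : ArcDigraph V A) (s : Finset ι) (x : ι → A → ℝ)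
    (v : V) : D.net (fun a => ∑ i ∈ s, x i a) v = ∑ i ∈ s, D.net (x i) v := by
  induction s using Finset.induction_on with
  | empty => simp [net_zero]
  | insert i s hi ih => simp only [sum_insert hi, net_add, ih]

theorem net_single [Fintype A] (D : ArcDigraph V A) (e : A) (r : ℝ) (v : V) :
    D.net (fun a => if a = e then r else 0) v
      = (if D.tail e = v then r else 0) - if D.head e = v then r else 0 := by
  have h : ∀ (q : A → V), (∑ a, if q a = v then (if a = e then r else 0) else 0)
      = if q e = v then r else 0 := by
    intro q
    rw [sum_eq_single e]
    · simp
    · intro a _ ha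
      simp [ha]
    · simp
  simp only [net, h]

theorem net_update [Fintype A] (D : ArcDigraph V A) (x : A → ℝ) (e : A) (r : ℝ) (v : V) :
    D.net (Function.update x e r) v = D.net x v
      + ((if D.tail e = v then r - x e else 0) - if D.head e = v then r - x e else 0) := by
  rw [← net_single, ← net_add]
  congr 1
  funext a
  by_cases h : a = e
  · subst h; simp
  · simp [h]

theorem isTransshipment_iff_net [Fintype A] (D : ArcDigraph V A) (b : V → ℝ) (x : A → ℝ) :
    D.IsTransshipment b x ↔ (∀ a, 0 ≤ x a) ∧ ∀ v, D.net x v = b v := by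
  simp only [IsTransshipment, net, sum_filter]

theorem IsWalk.append {D : ArcDigraph V A} {u v w : V} {l l' : List A} (h : D.IsWalk u v l)
    (h' : D.IsWalk v w l') : D.IsWalk u w (l ++ l') := by
  induction l generalizing u with
  | nil => cases h; exact h'
  | cons a l ih => exact ⟨h.1, ih h.2⟩

theorem isWalk_singleton {D : ArcDigraph V A} (a : A) : D.IsWalk (D.tail a) (D.head a) [a] :=
  ⟨rfl, rfl⟩

/-- Multiplicities are used because a walk may repeat arcs; this makes every walk a unit of flow, so
that walks can be cancelled or combined into circulations. -/
theorem IsWalk.net_count [Fintype A] {D : ArcDigraph V A} {u v : V} {l : List A}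
    (h : D.IsWalk u v l) (y : V) :
    D.net (fun a => (l.count a : ℝ)) y = (if u = y then 1 else 0) - if v = y then 1 else 0 := by
  induction l generalizing u with
  | nil => cases h; simp [net_zero]
  | cons b l ih =>
    have : (fun a => ((b :: l).count a : ℝ))
        = fun a => (l.count a : ℝ) + if a = b then 1 else 0 := by
      funext a
      rw [List.count_cons]
      by_cases hab : a = b
      · subst hab; simp
      · simp [hab, Ne.symm hab]
    rw [this, net_add, net_single, ih h.2, h.1]
    ring

theorem IsWalk.exists_head_eq {D : ArcDigraph V A} {u v : V} {l : List A} (h : D.IsWalk u v l)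
    (hl : l ≠ []) : ∃ a ∈ l, D.head a = v := by
  induction l generalizing u with
  | nil => exact absurd rfl hl
  | cons b l ih =>
    by_cases hl' : l = []
    · subst hl'
      exact ⟨b, by simp, h.2⟩
    · obtain ⟨a, ha, hv⟩ := ih h.2 hl'
      exact ⟨a, by simp [ha], hv⟩

theorem IsWalk.exists_tail_eq_head {D : ArcDigraph V A} {u v : V} {l : List A}
    (h : D.IsWalk u v l) {a : A} (ha : a ∈ l) (hv : D.head a ≠ v) :
    ∃ o ∈ l, D.tail o = D.head a := by
  induction l generalizing u with
  | nil => simp at ha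
  | cons b l ih =>
    rcases List.mem_cons.1 ha with rfl | ha
    · cases l with
      | nil => exact absurd h.2 hv
      | cons c l => exact ⟨c, by simp, h.2.1⟩
    · obtain ⟨o, ho, h'⟩ := ih h.2 ha
      exact ⟨o, by simp [ho], h'⟩

theorem IsWalk.rank_le {D : ArcDigraph V A} {u v : V} {l : List A} (h : D.IsWalk u v l)
    {r : V → ℕ} (hr : ∀ a ∈ l, r (D.tail a) < r (D.head a)) : r u ≤ r v := by
  induction l generalizing u with
  | nil => cases h; rfl
  | cons b l ih =>
    have h1 := hr b (by simp)
    rw [h.1] at h1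
    exact h1.le.trans (ih h.2 fun a ha => hr a (by simp [ha]))

theorem IsWalk.rank_lt {D : ArcDigraph V A} {u v : V} {l : List A} (h : D.IsWalk u v l)
    {r : V → ℕ} (hr : ∀ a ∈ l, r (D.tail a) < r (D.head a)) :
    ∀ a ∈ l, r u < r (D.head a) := by
  induction l generalizing u with
  | nil => simp
  | cons b l ih =>
    have h1 := hr b (by simp)
    rw [h.1] at h1
    intro a ha
    rcases List.mem_cons.1 ha with rfl | ha
    · exact h1
    · exact h1.trans (ih h.2 (fun a ha => hr a (by simp [ha])) a ha)

theorem IsWalk.isPath {D : ArcDigraph V A} {u v : V} {l : List A} (h : D.IsWalk u v l)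
    {r : V → ℕ} (hr : ∀ a ∈ l, r (D.tail a) < r (D.head a)) : D.IsPath u v l := by
  refine ⟨h, ?_⟩
  induction l generalizing u with
  | nil => simp
  | cons b l ih =>
    rw [List.nodup_cons]
    refine ⟨fun hm => ?_, ih h.2 fun a ha => hr a (by simp [ha])⟩
    obtain ⟨a, ha, hau⟩ := List.mem_map.1 hm
    have := h.rank_lt hr a ha
    rw [hau] at this
    exact this.false

/-- Consecutive arcs have equal colours, so a walk never leaves its copy. -/
theorem IsWalk.color_eq {D : ArcDigraph V A} {J : Type*} {κ : A → J}
    (hκ : ∀ a a', D.head a = D.tail a' → κ a = κ a') {u v : V} {l : List A}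
    (h : D.IsWalk u v l) {a a' : A} (ha : a ∈ l) (ha' : a' ∈ l) : κ a = κ a' := by
  have key : ∀ (l : List A) (u : V) (b : A), D.IsWalk u v (b :: l) → ∀ a ∈ b :: l, κ a = κ b := by
    intro l
    induction l with
    | nil => intro u b _ a ha; rw [List.mem_singleton.1 ha]
    | cons c l ih =>
      intro u b hw a ha
      rcases List.mem_cons.1 ha with rfl | ha
      · rfl
      · rw [ih _ c hw.2 a ha]
        exact (hκ b c hw.2.1.symm).symm
  cases l with
  | nil => simp at ha
  | cons b l => rw [key l u b h a ha, key l u b h a' ha']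

/-- Reachability by a nonempty walk in the support of `x` is witnessed by a list of arcs. -/
theorem exists_isWalk_of_transGen {D : ArcDigraph V A} {x : A → ℝ} {u v : V}
    (h : Relation.TransGen (fun u v => ∃ a, 0 < x a ∧ D.tail a = u ∧ D.head a = v) u v) :
    ∃ l, l ≠ [] ∧ D.IsWalk u v l ∧ ∀ a ∈ l, 0 < x a := by
  induction h with
  | single h =>
    obtain ⟨a, ha, rfl, rfl⟩ := h
    exact ⟨[a], by simp, isWalk_singleton a, by simpa using ha⟩
  | tail _ h ih =>
    obtain ⟨a, ha, rfl, rfl⟩ := h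
    obtain ⟨l, _, hw, hl⟩ := ih
    refine ⟨l ++ [a], by simp, hw.append (isWalk_singleton a), fun b hb => ?_⟩
    rcases List.mem_append.1 hb with hb | hb
    · exact hl b hb
    · rw [List.mem_singleton.1 hb]; exact ha

/-- Cancelling flow on directed cycles makes the support of a transshipment acyclic. -/
theorem exists_acyclic_transshipment [Fintype V] [Fintype A] (D : ArcDigraph V A) (b : V → ℝ)
    (c : A → ℝ) (h : ∃ x : A → ℝ, D.IsTransshipment b x ∧ ∀ a, x a ≤ c a) :
    ∃ (x : A → ℝ) (r : V → ℕ), D.IsTransshipment b x ∧ (∀ a, x a ≤ c a) ∧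
      ∀ a, 0 < x a → r (D.tail a) < r (D.head a) := by
  obtain ⟨x₀, hx₀⟩ := h
  obtain ⟨N, hN⟩ : ∃ N, N = #{a | 0 < x₀ a} := ⟨_, rfl⟩
  induction N using Nat.strong_induction_on generalizing x₀ with
  | _ N ih =>
  set R : V → V → Prop := fun u v => ∃ a, 0 < x₀ a ∧ D.tail a = u ∧ D.head a = v with hR
  by_cases hcyc : ∃ v, Relation.TransGen R v v
  · obtain ⟨v, hv⟩ := hcyc
    obtain ⟨l, hl, hw, hpos⟩ := exists_isWalk_of_transGen hv
    -- The closed walk may use an arc several times. The minimum of flow over multiplicity is the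
    -- largest amount that can be cancelled, and it empties `e`.
    obtain ⟨e, hel, hmin⟩ := l.toFinset.exists_min_image (fun a => x₀ a / l.count a)
      (by rwa [List.toFinset_nonempty_iff])
    have hcount : ∀ a ∈ l, 0 < (l.count a : ℝ) := fun a ha => by
      exact_mod_cast List.count_pos_iff.2 ha
    have he : e ∈ l := List.mem_toFinset.1 hel
    set ε := x₀ e / l.count e with hε
    have hεpos : 0 < ε := div_pos (hpos e he) (hcount e he)
    have hle : ∀ a, ε * l.count a ≤ x₀ a := by
      intro a
      by_cases ha : a ∈ l
      · have := hmin a (List.mem_toFinset.2 ha)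
        rwa [le_div_iff₀ (hcount a ha)] at this
      · rw [List.count_eq_zero_of_not_mem ha]
        simpa using hx₀.1.1 a
    refine ih _ ?_ (fun a => x₀ a + (-ε) * l.count a) ⟨?_, fun a => ?_⟩ rfl
    · rw [hN]
      refine card_lt_card ⟨fun a ha => ?_, fun hsub => ?_⟩
      · simp only [mem_filter, mem_univ, true_and] at ha ⊢
        have : 0 ≤ ε * l.count a := by positivity
        linarith
      · have := hsub (show e ∈ _ by simpa using hpos e he)
        simp only [mem_filter, mem_univ, true_and] at this
        have h2 : ε * l.count e = x₀ e := div_mul_cancel₀ _ (hcount e he).ne'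
        linarith
    · rw [isTransshipment_iff_net] at *
      refine ⟨fun a => by have := hle a; linarith, fun y => ?_⟩
      rw [net_add, net_smul, hw.net_count, hx₀.1.2]
      ring
    · have : 0 ≤ ε * l.count a := by positivity
      have := hx₀.2 a
      linarith
  -- The rank of `v` is the number of vertices that reach it by a nonempty walk. It grows strictly
  -- along an arc, as the tail reaches the head but, without cycles, not itself.
  · refine ⟨x₀, fun v => #{u | Relation.TransGen R u v}, hx₀.1, hx₀.2, fun a ha => ?_⟩
    have hstep : R (D.tail a) (D.head a) := ⟨a, ha, rfl, rfl⟩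
    refine card_lt_card ⟨fun u hu => ?_, fun hsub => ?_⟩
    · simp only [mem_filter, mem_univ, true_and] at hu ⊢
      exact hu.tail hstep
    · have := hsub (show D.tail a ∈ _ by simpa using Relation.TransGen.single hstep)
      simp only [mem_filter, mem_univ, true_and] at this
      exact hcyc ⟨_, this⟩

end ArcDigraph

end

/-! ### Path routing of a flow whose support does not branch -/

noncomputable section

namespace ArcDigraph

open scoped Classical

variable {W E T J : Type*}

/-- The amount of flow on arc `a` with destination `t`, if `f s t` is sent along `P s t`. -/
def arcLoad [Fintype W] (f : W → T → ℝ) (P : W → T → List E) (a : E) (t : T) : ℝ :=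
  ∑ s, if a ∈ P s t then f s t else 0

theorem arcLoad_nonneg [Fintype W] {f : W → T → ℝ} {P : W → T → List E} (hf : ∀ s t, 0 ≤ f s t)
    (a : E) (t : T) : 0 ≤ arcLoad f P a t :=
  sum_nonneg fun s _ => by split_ifs <;> simp [hf]

theorem arcLoad_le [Fintype W] {f : W → T → ℝ} {P : W → T → List E} (hf : ∀ s t, 0 ≤ f s t)
    (a : E) (t : T) : arcLoad f P a t ≤ ∑ s, f s t :=
  sum_le_sum fun s _ => by split_ifs <;> simp [hf]

theorem exists_of_arcLoad_ne_zero [Fintype W] {f : W → T → ℝ} {P : W → T → List E} {a : E} {t : T}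
    (h : arcLoad f P a t ≠ 0) : ∃ s, f s t ≠ 0 ∧ a ∈ P s t := by
  by_contra! hc
  refine h (sum_eq_zero fun s _ => ?_)
  by_cases hs : f s t = 0
  · simp [hs]
  · simp [hc s hs]

/-- A flow whose support has out-degrees at most one can be decomposed into paths, one for each
pair of a supply vertex and a terminal. -/
theorem exists_forest_routing [Fintype W] [Fintype E] [Fintype T] (H : ArcDigraph W E)
    (r : W → ℕ) (hr : ∀ a, r (H.tail a) < r (H.head a)) (x : E → ℝ) (σ : W → ℝ) (pos : T → W)
    (d : T → ℝ) (hx : ∀ a, 0 ≤ x a) (hσ : ∀ v, 0 ≤ σ v) (hd : ∀ t, 0 ≤ d t)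
    (hbal : ∀ v, H.net x v = σ v - ∑ t, if pos t = v then d t else 0)
    (hout : ∀ a a', 0 < x a → 0 < x a' → H.tail a = H.tail a' → a = a') :
    ∃ (f : W → T → ℝ) (P : W → T → List E), (∀ s t, 0 ≤ f s t) ∧
      (∀ s t, f s t ≠ 0 → H.IsWalk s (pos t) (P s t) ∧ ∀ a ∈ P s t, 0 < x a) ∧
      (∀ s, ∑ t, f s t = σ s) ∧ (∀ t, ∑ s, f s t = d t) ∧
      ∀ a, ∑ t, arcLoad f P a t ≤ x a := by
  obtain ⟨N, hN⟩ : ∃ N, N = #{a | 0 < x a} := ⟨_, rfl⟩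
  induction N using Nat.strong_induction_on generalizing x σ with
  | _ N ih =>
  by_cases hsupp : ∃ a, 0 < x a
  swap
  · push Not at hsupp
    have hx0 : x = fun _ => 0 := funext fun a => le_antisymm (hsupp a) (hx a)
    refine ⟨fun s t => if pos t = s then d t else 0, fun _ _ => [], fun s t => ?_,
      fun s t h => ?_, fun s => ?_, fun t => ?_, fun a => ?_⟩
    · dsimp only; split_ifs <;> simp [hd]
    · by_cases h' : pos t = s
      · exact ⟨h'.symm, by simp⟩
      · simp [h'] at h
    · have := hbal s
      rw [hx0, net_zero] at this
      linarith
    · simp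
    · simp [arcLoad, hx]
  -- With a tail `u` of least rank, no flow enters `u`, and `e` is the only arc on which flow leaves
  -- it. Hence the supply at `u` covers `x e`.
  obtain ⟨e, he, hmin⟩ := ({a | 0 < x a} : Finset E).exists_min_image (fun a => r (H.tail a))
    (by obtain ⟨a, ha⟩ := hsupp; exact ⟨a, by simpa using ha⟩)
  simp only [mem_filter, mem_univ, true_and] at he hmin
  obtain ⟨u, hu⟩ : ∃ u, u = H.tail e := ⟨_, rfl⟩
  obtain ⟨z, hz⟩ : ∃ z, z = H.head e := ⟨_, rfl⟩
  have huz : r u < r z := by rw [hu, hz]; exact hr e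
  have hne : z ≠ u := fun h => by rw [h] at huz; exact huz.false
  have hin : ∀ a, H.head a = u → x a = 0 := by
    intro a ha
    by_contra h0
    have h1 := hmin a (lt_of_le_of_ne (hx a) (Ne.symm h0))
    have h2 := hr a
    rw [ha, hu] at h2
    exact absurd h1 (not_le.2 h2)
  have houtu : ∀ a, H.tail a = u → a ≠ e → x a = 0 := by
    intro a ha hae
    by_contra h0
    exact hae (hout a e (lt_of_le_of_ne (hx a) (Ne.symm h0)) he (ha.trans hu))
  have hnetu : H.net x u = x e := by
    unfold net
    rw [sum_eq_single e, if_pos hu.symm, sum_eq_zero, sub_zero]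
    · intro a _
      split_ifs with h
      · exact hin a h
      · rfl
    · intro a _ hae
      split_ifs with h
      · exact houtu a h hae
      · rfl
    · simp
  have hσu : x e ≤ σ u := by
    have h1 := hbal u
    have h2 : 0 ≤ ∑ t, if pos t = u then d t else 0 :=
      sum_nonneg fun t _ => by split_ifs <;> simp [hd]
    linarith
  have hxe0 : ∀ a, 0 < Function.update x e 0 a → a ≠ e ∧ 0 < x a := by
    intro a ha
    by_cases h : a = e
    · subst h; simp at ha
    · exact ⟨h, by simpa [h] using ha⟩
  -- Induction: delete `e` and hand `x e` units of supply from `u` to the head `z`.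
  obtain ⟨f, P, hf, hP, hfs, hft, hload⟩ := ih #{a | 0 < Function.update x e 0 a}
    (by
      rw [hN]
      refine card_lt_card ⟨fun a ha => ?_, fun hsub => ?_⟩
      · simp only [mem_filter, mem_univ, true_and] at ha ⊢
        exact (hxe0 a ha).2
      · have := hsub (show e ∈ _ by simpa using he)
        simp at this)
    (Function.update x e 0)
    (fun v => σ v + ((if z = v then x e else 0) - if u = v then x e else 0))
    (fun a => by
      by_cases h : a = e
      · subst h; simp
      · simpa [h] using hx a)
    (fun v => by
      have h1 := hσ v
      by_cases hv : u = v
      · subst hv; simp [hne, hσu]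
      · by_cases hv' : z = v
        · subst hv'; simp [hv]; linarith
        · simpa [hv, hv'] using h1)
    (fun v => by
      rw [net_update, hbal v, ← hu, ← hz]
      split_ifs <;> ring)
    (fun a a' ha ha' => hout a a' (hxe0 a ha).2 (hxe0 a' ha').2) rfl
  have hfu : ∀ t, pos t ≠ u → f u t = 0 := by
    intro t ht
    by_contra h0
    obtain ⟨hw, hs⟩ := hP u t h0
    cases hPu : P u t with
    | nil => rw [hPu] at hw; exact ht hw.symm
    | cons a l =>
      rw [hPu] at hw hs
      obtain ⟨h1, h2⟩ := hxe0 a (hs a (by simp))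
      have := houtu a hw.1 h1
      linarith
  have hfz : ∀ t, pos t = u → f z t = 0 := by
    intro t ht
    by_contra h0
    have := (hP z t h0).1.rank_le (r := r) fun a _ => hr a
    rw [ht] at this
    omega
  have heP : ∀ s t, f s t ≠ 0 → e ∉ P s t := fun s t h hmem => by
    have := (hP s t h).2 e hmem
    simp at this
  have hσz : (∑ t, f z t) = σ z + x e := by
    rw [hfs z]; simp [hne.symm]
  have hσz0 : 0 < σ z + x e := by have := hσ z; linarith
  -- The supply at `z` mixes its own part with the `x e` units taken from `u`. The fraction `θ` of
  -- every amount sent from `z` is given back to `u`, along the same path preceded by `e`; in total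
  -- this puts `x e` on `e`.
  set θ := x e / (σ z + x e) with hθ
  have hθ0 : 0 ≤ θ := by positivity
  have hθ1 : θ ≤ 1 := by
    rw [hθ, div_le_one hσz0]; have := hσ z; linarith
  have hθz : θ * (σ z + x e) = x e := div_mul_cancel₀ _ hσz0.ne'
  refine ⟨fun s t => f s t + ((if s = u then 1 else 0) - if s = z then 1 else 0) * (θ * f z t),
    fun s t => if s = u ∧ pos t ≠ u then e :: P z t else P s t, fun s t => ?_, fun s t h => ?_,
    fun s => ?_, fun t => ?_, fun a => ?_⟩
  · by_cases hs : s = u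
    · subst hs
      have := mul_nonneg hθ0 (hf z t)
      have := hf s t
      simp [hne.symm]; linarith
    · by_cases hs' : s = z
      · subst hs'
        have := hf s t
        simp [hs]; nlinarith
      · simpa [hs, hs'] using hf s t
  · by_cases hs : s = u
    · subst hs
      by_cases ht : pos t = s
      · simp only [hfz t ht, mul_zero, add_zero] at h
        obtain ⟨h1, h2⟩ := hP s t h
        simp only [ht, ne_eq, not_true_eq_false, and_false, if_false]
        rw [ht] at h1
        exact ⟨h1, fun a ha => (hxe0 a (h2 a ha)).2⟩
      · have hz0 : f z t ≠ 0 := by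
          intro h0
          simp [hfu t ht, h0] at h
        obtain ⟨h1, h2⟩ := hP z t hz0
        simp only [ne_eq, ht, not_false_eq_true, and_true, if_true]
        refine ⟨⟨hu.symm, hz ▸ h1⟩, fun a ha => ?_⟩
        rcases List.mem_cons.1 ha with rfl | ha
        · exact he
        · exact (hxe0 a (h2 a ha)).2
    · have h0 : f s t ≠ 0 := by
        intro h0
        by_cases hs' : s = z
        · subst hs'; simp [h0] at h
        · simp [hs, hs', h0] at h
      obtain ⟨h1, h2⟩ := hP s t h0
      simp only [hs, false_and, if_false]
      exact ⟨h1, fun a ha => (hxe0 a (h2 a ha)).2⟩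
  · rw [sum_add_distrib, ← mul_sum, ← mul_sum, hσz, hθz, hfs s]
    by_cases hs : s = u
    · subst hs; simp [hne, hne.symm]
    · by_cases hs' : s = z
      · subst hs'; simp [hs, hne.symm]
      · simp [hs, hs', Ne.symm hs, Ne.symm hs']
  · rw [sum_add_distrib, ← sum_mul, sum_sub_distrib]
    simp [hft t]
  · by_cases hae : a = e
    · subst hae
      calc _ ≤ ∑ t, θ * f z t := ?_
        _ = x a := by rw [← mul_sum, hσz, hθz]
      refine sum_le_sum fun t _ => ?_
      have hzt : 0 ≤ θ * f z t := mul_nonneg hθ0 (hf z t)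
      rw [arcLoad, sum_eq_single u]
      · by_cases ht : pos t = u
        · have : (if a ∈ P u t then f u t else 0) = 0 := by
            by_cases h0 : f u t = 0
            · simp [h0]
            · simp [heP u t h0]
          simpa [ht, hfz t ht] using this.le
        · simp [ht, hfu t ht, hne.symm]
      · intro s _ hs
        by_cases h0 : f s t = 0
        · by_cases hs' : s = z
          · subst hs'; simp [h0]
          · simp [h0, hs, hs']
        · simp [hs, heP s t h0]
      · simp
    · have hxa : Function.update x e 0 a = x a := by simp [hae]
      rw [← hxa]
      refine le_trans (le_of_eq (sum_congr rfl fun t _ => ?_)) (hload a)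
      have key : ∀ s, (if a ∈ (if s = u ∧ pos t ≠ u then e :: P z t else P s t) then
          f s t + ((if s = u then 1 else 0) - if s = z then 1 else 0) * (θ * f z t) else 0)
          = (if a ∈ P s t then f s t else 0) + ((if s = u then 1 else 0) - if s = z then 1 else 0)
            * (if a ∈ P z t then θ * f z t else 0) := by
        intro s
        by_cases hs : s = u
        · subst hs
          by_cases ht : pos t = s
          · simp [ht, hfz t ht]
          · simp [ht, hae, hfu t ht, hne.symm]
        · by_cases hs' : s = z
          · subst hs'
            simp only [hs, false_and, if_false, if_true]
            split_ifs <;> ring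
          · simp [hs, hs']
      simp only [arcLoad, key]
      rw [sum_add_distrib, ← sum_mul, sum_sub_distrib]
      simp

end ArcDigraph

end

/-! ### States, routings, and moving a terminal backwards -/

noncomputable section

namespace ArcDigraph

open scoped Classical

variable {W E T J : Type*}

/-- A flow `x` with supplies `σ` and terminals `t` at `pos t` with demand `d t`, together with a set
`Z` of vertices from which the support of the flow can be followed in at most one way. Flow on the
arcs into `Z` is bounded in terms of the demands at the head. -/
structure IsState [Fintype E] [Fintype T] (H : ArcDigraph W E) (κ : E → J) (x : E → ℝ) (σ : W → ℝ)
    (pos : T → W) (d : T → ℝ) (Z : Set W) : Prop where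
  x_nonneg : ∀ a, 0 ≤ x a
  supply_nonneg : ∀ v, 0 ≤ σ v
  demand_nonneg : ∀ t, 0 ≤ d t
  balance : ∀ v, H.net x v = σ v - ∑ t, if pos t = v then d t else 0
  mono : ∀ a a' t t', H.head a = pos t → H.head a' = pos t → pos t' = pos t → κ a ≠ κ a' → t = t'
  out_unique : ∀ a a', H.tail a ∈ Z → H.tail a = H.tail a' → 0 < x a → 0 < x a' → a = a'
  closed : ∀ a, 0 < x a → H.tail a ∈ Z → H.head a ∈ Z
  le_max : ∀ a t t', 0 < x a → H.head a ∈ Z → pos t = H.head a → pos t' = H.head a → t ≠ t' →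
    0 < d t → 0 < d t' → x a ≤ max (d t) (d t')
  le_demand : ∀ a o t, 0 < x a → H.head a ∈ Z → pos t = H.head a → 0 < x o →
    H.tail o = H.head a → 0 < d t → x a ≤ d t

/-- A path routing of all demands in which terminal `t` receives the amount `g t j` along arcs of
colour `j`; the flow to any set of terminals exceeds `x` on an arc by at most the largest of these
amounts, and on an arc into `Z` it is at most that. -/
structure IsRouting [Fintype W] [Fintype T] [Fintype J] (H : ArcDigraph W E) (κ : E → J)
    (x : E → ℝ) (σ : W → ℝ) (pos : T → W) (d : T → ℝ) (Z : Set W)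
    (f : W → T → ℝ) (P : W → T → List E) (p : T → J) (g : T → J → ℝ) : Prop where
  nonneg : ∀ s t, 0 ≤ f s t
  walk : ∀ s t, f s t ≠ 0 → H.IsWalk s (pos t) (P s t) ∧ ∀ a ∈ P s t, 0 < x a
  sum_supply : ∀ s, ∑ t, f s t = σ s
  sum_demand : ∀ t, ∑ s, f s t = d t
  color_nonneg : ∀ t j, 0 ≤ g t j
  sum_color : ∀ t, ∑ j, g t j = d t
  load_le_color : ∀ a t, arcLoad f P a t ≤ g t (κ a)
  load_le : ∀ a (S : Finset T) (μ : ℝ), 0 ≤ μ →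
    (∀ t ∈ S, arcLoad f P a t ≠ 0 → g t (κ a) ≤ μ) →
    ∑ t ∈ S, arcLoad f P a t ≤ (if H.head a ∈ Z then 0 else x a) + μ
  unique : ∀ a t t', arcLoad f P a t ≠ 0 → arcLoad f P a t' ≠ 0 → p t ≠ κ a → p t' ≠ κ a → t = t'

/-- The demands of the state can be routed. -/
def Routable [Fintype W] [Fintype T] [Fintype J] (H : ArcDigraph W E) (κ : E → J)
    (x : E → ℝ) (σ : W → ℝ) (pos : T → W) (d : T → ℝ) (Z : Set W) : Prop :=
  ∃ f P p g, IsRouting H κ x σ pos d Z f P p g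

theorem IsWalk.color_of_tail_eq {D : ArcDigraph W E} {κ : E → J}
    (hκ : ∀ a a', D.head a = D.tail a' → κ a = κ a') {u : W} {e : E} {l : List E}
    (h : D.IsWalk u (D.tail e) l) {a : E} (ha : a ∈ l) : κ a = κ e :=
  (h.append (isWalk_singleton e)).color_eq hκ (by simp [ha]) (by simp)

/-- The colour of a walk, with a default for the empty walk. -/
def walkColor (κ : E → J) (j : J) : List E → J
  | [] => j
  | a :: _ => κ a

theorem IsWalk.walkColor_eq {D : ArcDigraph W E} {κ : E → J}
    (hκ : ∀ a a', D.head a = D.tail a' → κ a = κ a') {u v : W}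
    {l : List E} (h : D.IsWalk u v l) (j : J) {a : E} (ha : a ∈ l) : walkColor κ j l = κ a := by
  cases l with
  | nil => simp at ha
  | cons b l => exact h.color_eq hκ (by simp) ha

variable [Fintype W] [Fintype T] [Fintype J] {H : ArcDigraph W E} {κ : E → J}
  {x : E → ℝ} {σ : W → ℝ} {pos : T → W} {d : T → ℝ} {Z : Set W}

/-- A routing after moving the terminal `t₀` back along the arc `e` yields one before the move. -/
theorem Routable.of_move (hκ : ∀ a a', H.head a = H.tail a' → κ a = κ a')
    {e : E} {t₀ : T} (he : H.head e = pos t₀) (hd0 : 0 < d t₀)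
    (hle : d t₀ ≤ x e) (hZ : H.head e ∈ Z → x e = d t₀)
    (h : Routable H κ (Function.update x e (x e - d t₀)) σ (Function.update pos t₀ (H.tail e)) d Z) :
    Routable H κ x σ pos d Z := by
  obtain ⟨f, P, p, g, h⟩ := h
  have hxe : ∀ a, Function.update x e (x e - d t₀) a ≤ x a := fun a => by
    by_cases hae : a = e
    · subst hae; simp [hd0.le]
    · simp [hae]
  set P' : W → T → List E := fun s t => if t = t₀ then P s t ++ [e] else P s t with hP'
  have hmem : ∀ s t a, a ∈ P' s t ↔ a ∈ P s t ∨ (t = t₀ ∧ a = e) := by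
    intro s t a
    by_cases ht : t = t₀ <;> simp [hP', ht]
  have hloadne : ∀ a t, t ≠ t₀ → arcLoad f P' a t = arcLoad f P a t := by
    intro a t ht
    simp [arcLoad, hmem, ht]
  have hloadae : ∀ a t, a ≠ e → arcLoad f P' a t = arcLoad f P a t := by
    intro a t ht
    simp [arcLoad, hmem, ht]
  have hload0 : arcLoad f P' e t₀ = d t₀ := by
    simp only [arcLoad, hmem, and_self, or_true, if_true]
    exact h.sum_demand t₀
  have hcol : ∀ a, arcLoad f P a t₀ ≠ 0 → κ a = κ e := by
    intro a ha
    obtain ⟨s, hs, has⟩ := exists_of_arcLoad_ne_zero ha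
    have := (h.walk s t₀ hs).1
    rw [Function.update_self] at this
    exact this.color_of_tail_eq hκ has
  have hcol' : ∀ a, arcLoad f P' a t₀ ≠ 0 → κ a = κ e := by
    intro a ha
    by_cases hae : a = e
    · rw [hae]
    · rw [hloadae a t₀ hae] at ha
      exact hcol a ha
  have hgle : ∀ j, g t₀ j ≤ d t₀ := fun j => by
    rw [← h.sum_color t₀]
    exact single_le_sum (f := g t₀) (fun j _ => h.color_nonneg t₀ j) (mem_univ j)
  -- All walks to `t₀` now end with `e`, and walks have a single colour. Thus `t₀` receives its
  -- whole demand in the colour of `e`, which becomes its preferred one.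
  refine ⟨f, P', Function.update p t₀ (κ e),
    Function.update g t₀ (fun j => if j = κ e then d t₀ else 0), h.nonneg, ?_, h.sum_supply,
    h.sum_demand, ?_, ?_, ?_, ?_, ?_⟩
  · intro s t hst
    obtain ⟨h1, h2⟩ := h.walk s t hst
    by_cases ht : t = t₀
    · subst ht
      rw [Function.update_self] at h1
      simp only [hP', if_true]
      refine ⟨he ▸ h1.append (isWalk_singleton e), fun a ha => ?_⟩
      rcases List.mem_append.1 ha with ha | ha
      · exact (h2 a ha).trans_le (hxe a)
      · rw [List.mem_singleton.1 ha]; exact hd0.trans_le hle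
    · simp only [hP', ht, if_false]
      rw [Function.update_of_ne ht] at h1
      exact ⟨h1, fun a ha => (h2 a ha).trans_le (hxe a)⟩
  · intro t j
    by_cases ht : t = t₀
    · subst ht; rw [Function.update_self]; split_ifs <;> simp [hd0.le]
    · rw [Function.update_of_ne ht]; exact h.color_nonneg t j
  · intro t
    by_cases ht : t = t₀
    · subst ht; rw [Function.update_self]; simp
    · rw [Function.update_of_ne ht]; exact h.sum_color t
  · intro a t
    by_cases ht : t = t₀
    · subst ht
      rw [Function.update_self]
      by_cases h0 : arcLoad f P' a t = 0
      · rw [h0]; split_ifs <;> simp [hd0.le]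
      · rw [if_pos (hcol' a h0)]
        exact (arcLoad_le h.nonneg a t).trans (h.sum_demand t).le
    · rw [Function.update_of_ne ht, hloadne a t ht]; exact h.load_le_color a t
  · intro a S μ hμ hS
    by_cases hae : a = e
    · subst hae
      have h1 := h.load_le a (S.erase t₀) μ hμ (fun t ht h0 => by
        have ht' := Finset.ne_of_mem_erase ht
        have := hS t (Finset.mem_of_mem_erase ht) (by rwa [hloadne a t ht'])
        rwa [Function.update_of_ne ht'] at this)
      rw [Function.update_self] at h1
      have h2 : ∑ t ∈ S.erase t₀, arcLoad f P' a t = ∑ t ∈ S.erase t₀, arcLoad f P a t :=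
        sum_congr rfl fun t ht => hloadne a t (Finset.ne_of_mem_erase ht)
      by_cases hmem0 : t₀ ∈ S
      · rw [← Finset.add_sum_erase S _ hmem0, hload0, h2]
        have hdμ : d t₀ ≤ μ := by
          have := hS t₀ hmem0 (by rw [hload0]; exact hd0.ne')
          simpa using this
        -- If `e` leads into `Z`, the move has used up its flow, so `t₀` is the only terminal served
        -- through it. Otherwise the `d t₀` units by which `x e` was lowered pay for the new load of
        -- `t₀`.
        by_cases hZ' : H.head a ∈ Z
        · have hz : ∀ t ∈ S.erase t₀, arcLoad f P a t = 0 := by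
            intro t _
            by_contra h0
            obtain ⟨s, hs, has⟩ := exists_of_arcLoad_ne_zero h0
            have := (h.walk s t hs).2 a has
            rw [Function.update_self, hZ hZ'] at this
            simp at this
          rw [sum_eq_zero hz, if_pos hZ']
          linarith
        · rw [if_neg hZ'] at h1 ⊢
          linarith
      · rw [Finset.erase_eq_of_notMem hmem0] at h1 h2
        rw [h2]
        refine h1.trans ?_
        split_ifs <;> linarith
    · have h1 := h.load_le a S μ hμ (fun t ht h0 => by
        have := hS t ht (by rwa [hloadae a t hae])
        by_cases htt : t = t₀
        · subst htt
          rw [Function.update_self, if_pos (hcol a h0)] at this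
          exact (hgle _).trans this
        · rwa [Function.update_of_ne htt] at this)
      rw [Function.update_of_ne hae] at h1
      rwa [sum_congr rfl fun t _ => hloadae a t hae]
  · intro a t t' h0 h0' hp hp'
    have hne : ∀ t, arcLoad f P' a t ≠ 0 → Function.update p t₀ (κ e) t ≠ κ a → t ≠ t₀ := by
      rintro t h0 hp rfl
      rw [Function.update_self] at hp
      exact hp (hcol' a h0).symm
    have ht := hne t h0 hp
    have ht' := hne t' h0' hp'
    rw [Function.update_of_ne ht] at hp
    rw [Function.update_of_ne ht'] at hp'
    rw [hloadne a t ht] at h0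
    rw [hloadne a t' ht'] at h0'
    exact h.unique a t t' h0 h0' hp hp'

end ArcDigraph

end

/-! ### Routing a tree that no branching vertex feeds, except through one arc -/

noncomputable section

namespace ArcDigraph

open scoped Classical

variable {W E T J : Type*} [Fintype E] [Fintype T] {H : ArcDigraph W E} {κ : E → J}
  {x : E → ℝ} {σ : W → ℝ} {pos : T → W} {d : T → ℝ} {Z : Set W}

/-- Balance of the part of a flow inside a set `Y` that is entered from outside by the arc `e`
only. -/
theorem IsState.balance_inside (hs : IsState H κ x σ pos d Z) {Y : Set W} {e : E} {t₀ : T}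
    (heY : H.head e ∈ Y) (hte : H.tail e ∉ Y) (ht₀ : pos t₀ = H.head e)
    (hYin : ∀ a, 0 < x a → H.head a ∈ Y → a ≠ e → H.tail a ∈ Y)
    (hYout : ∀ a, 0 < x a → H.tail a ∈ Y → H.head a ∈ Y) (v : W) :
    H.net (fun a => if H.head a ∈ Y ∧ a ≠ e then x a else 0) v = (if v ∈ Y then σ v else 0)
      - ∑ t, if pos t = v then
          (if t = t₀ then d t₀ - x e else if pos t ∈ Y then d t else 0) else 0 := by
  have hpos : ∀ a, x a ≠ 0 → 0 < x a := fun a h => lt_of_le_of_ne (hs.x_nonneg a) (Ne.symm h)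
  by_cases hv : v ∈ Y
  · have h1 : H.net (fun a => if H.head a ∈ Y ∧ a ≠ e then x a else 0) v
        = H.net x v + if H.head e = v then x e else 0 := by
      have hin : (∑ a, if H.head a = v then (if H.head a ∈ Y ∧ a ≠ e then x a else 0) else 0)
          = (∑ a, if H.head a = v then x a else 0) - if H.head e = v then x e else 0 := by
        rw [eq_sub_iff_add_eq, show (if H.head e = v then x e else 0)
          = ∑ a, if a = e then (if H.head a = v then x a else 0) else 0 by simp,
          ← sum_add_distrib]
        refine sum_congr rfl fun a _ => ?_
        by_cases ha : H.head a = v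
        · by_cases hae : a = e
          · simp [hae]
          · simp [ha, hae, hv]
        · simp [ha]
      have hout : (∑ a, if H.tail a = v then (if H.head a ∈ Y ∧ a ≠ e then x a else 0) else 0)
          = ∑ a, if H.tail a = v then x a else 0 := by
        refine sum_congr rfl fun a _ => ?_
        by_cases ha : H.tail a = v
        · rw [if_pos ha, if_pos ha]
          by_cases h0 : x a = 0
          · simp [h0]
          · rw [if_pos]
            refine ⟨hYout a (hpos a h0) (ha ▸ hv), ?_⟩
            rintro rfl
            exact hte (ha ▸ hv)
        · simp [ha]
      simp only [net, hin, hout]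
      ring
    rw [h1, hs.balance v, if_pos hv]
    have h2 : (∑ t, if pos t = v then
          (if t = t₀ then d t₀ - x e else if pos t ∈ Y then d t else 0) else 0)
          = (∑ t, if pos t = v then d t else 0) - if H.head e = v then x e else 0 := by
      rw [eq_sub_iff_add_eq, show (if H.head e = v then x e else 0)
          = ∑ t, if t = t₀ then (if pos t = v then x e else 0) else 0 by simp [ht₀],
          ← sum_add_distrib]
      refine sum_congr rfl fun t _ => ?_
      by_cases ht : pos t = v
      · by_cases htt : t = t₀
        · subst htt
          simp [ht]
        · simp [ht, htt, hv]
      · simp [ht]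
    rw [h2]
    ring
  · have hin : (∑ a, if H.head a = v then (if H.head a ∈ Y ∧ a ≠ e then x a else 0) else 0)
        = 0 := by
      refine sum_eq_zero fun a _ => ?_
      by_cases ha : H.head a = v
      · simp [ha, hv]
      · simp [ha]
    have hout : (∑ a, if H.tail a = v then (if H.head a ∈ Y ∧ a ≠ e then x a else 0) else 0)
        = 0 := by
      refine sum_eq_zero fun a _ => ?_
      by_cases ha : H.tail a = v
      · by_cases h0 : x a = 0
        · simp [h0]
        · rw [if_pos ha, if_neg]
          rintro ⟨h1, h2⟩
          exact hv (ha ▸ hYin a (hpos a h0) h1 h2)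
      · simp [ha]
    rw [net, hin, hout, if_neg hv, sum_eq_zero]
    intro t _
    by_cases ht : pos t = v
    · have : t ≠ t₀ := by
        rintro rfl
        exact hv (ht ▸ ht₀ ▸ heY)
      simp [ht, this, hv]
    · simp [ht]

/-- The flow `x` is the sum of its parts outside and inside `Y` and of the arc `e`, so this follows
from `balance_inside` by subtraction. The terminal `t₀`, with demand `x e` at the tail of `e`,
absorbs what `e` used to carry into `Y`. -/
theorem IsState.balance_outside (hs : IsState H κ x σ pos d Z) {Y : Set W} {e : E} {t₀ : T}
    (heY : H.head e ∈ Y) (hte : H.tail e ∉ Y) (ht₀ : pos t₀ = H.head e)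
    (hYin : ∀ a, 0 < x a → H.head a ∈ Y → a ≠ e → H.tail a ∈ Y)
    (hYout : ∀ a, 0 < x a → H.tail a ∈ Y → H.head a ∈ Y) (v : W) :
    H.net (fun a => if H.head a ∈ Y then 0 else x a) v = (if v ∈ Y then 0 else σ v)
      - ∑ t, if Function.update pos t₀ (H.tail e) t = v then
          (if t = t₀ then x e else if pos t ∈ Y then 0 else d t) else 0 := by
  have h1 := hs.balance_inside heY hte ht₀ hYin hYout v
  have h2 := hs.balance v
  have h3 := H.net_single e (x e) v
  have h4 : H.net x v = H.net (fun a => if H.head a ∈ Y then 0 else x a) v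
      + H.net (fun a => if H.head a ∈ Y ∧ a ≠ e then x a else 0) v
      + H.net (fun a => if a = e then x e else 0) v := by
    rw [← net_add, ← net_add]
    congr 1
    funext a
    by_cases hae : a = e
    · subst hae; simp [heY]
    · by_cases ha : H.head a ∈ Y <;> simp [ha, hae]
  have h5 : (∑ t, if Function.update pos t₀ (H.tail e) t = v then
          (if t = t₀ then x e else if pos t ∈ Y then 0 else d t) else 0)
        = (if H.tail e = v then x e else 0) - (if H.head e = v then x e else 0)
          + (∑ t, if pos t = v then d t else 0)
          - ∑ t, if pos t = v then
          (if t = t₀ then d t₀ - x e else if pos t ∈ Y then d t else 0) else 0 := by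
    rw [show (if H.tail e = v then x e else 0) - (if H.head e = v then x e else 0)
      = ∑ t, if t = t₀ then (if H.tail e = v then x e else 0) - (if H.head e = v then x e else 0)
        else 0 by simp, ← sum_add_distrib, ← sum_sub_distrib]
    refine sum_congr rfl fun t _ => ?_
    by_cases ht : t = t₀
    · subst ht
      simp only [Function.update_self, ht₀, if_true]
      split_ifs <;> ring
    · simp only [Function.update_of_ne ht, ht, if_false]
      split_ifs <;> ring
  have h6 : (if v ∈ Y then 0 else σ v) = σ v - if v ∈ Y then σ v else 0 := by
    split_ifs <;> ring
  rw [h5, h6]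
  linarith

variable [Fintype W] [Fintype J]

/-- If the support of the flow inside `Y` is an in-tree with root `head e`, and `e` is the only arc
that enters `Y`, then the demands in `Y` can be routed inside `Y`, except for a part of the demand
of one terminal `t₀` at the root, which is moved to the tail of `e`. -/
theorem Routable.of_dead_tree (r : W → ℕ) (hr : ∀ a, r (H.tail a) < r (H.head a))
    (hκ : ∀ a a', H.head a = H.tail a' → κ a = κ a')
    (hs : IsState H κ x σ pos d Z) {Y : Set W} {e : E} {t₀ : T} (he : 0 < x e)
    (heY : H.head e ∈ Y) (hte : H.tail e ∉ Y) (ht₀ : pos t₀ = H.head e) (hle : x e ≤ d t₀)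
    (hYin : ∀ a, 0 < x a → H.head a ∈ Y → a ≠ e → H.tail a ∈ Y)
    (hYout : ∀ a, 0 < x a → H.tail a ∈ Y → H.head a ∈ Y) (hYZ : Y ⊆ Z)
    (hw : ∀ a, 0 < x a → H.tail a ≠ H.head e)
    (hstep : ∀ v ∈ Y, v ≠ H.head e → ∃ o, 0 < x o ∧ H.tail o = v)
    (h : Routable H κ (fun a => if H.head a ∈ Y then 0 else x a) (fun v => if v ∈ Y then 0 else σ v)
      (Function.update pos t₀ (H.tail e))
      (fun t => if t = t₀ then x e else if pos t ∈ Y then 0 else d t) Z) :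
    Routable H κ x σ pos d Z := by
  obtain ⟨f', P', p', g', h⟩ := h
  -- Inside `Y ⊆ Z` the support has out-degrees at most one. There `t₀` asks only for `d t₀ - x e`;
  -- the remaining `x e` arrives over `e` from the routing outside.
  obtain ⟨f'', P'', hf, hP, hfs, hft, hload⟩ := exists_forest_routing H r hr
    (fun a => if H.head a ∈ Y ∧ a ≠ e then x a else 0) (fun v => if v ∈ Y then σ v else 0) pos
    (fun t => if t = t₀ then d t₀ - x e else if pos t ∈ Y then d t else 0)
    (fun a => by split_ifs <;> simp [hs.x_nonneg])
    (fun v => by split_ifs <;> simp [hs.supply_nonneg])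
    (fun t => by split_ifs <;> simp [hs.demand_nonneg, hle])
    (hs.balance_inside heY hte ht₀ hYin hYout) (fun a a' ha ha' haa' => by
      have hh : ∀ b, 0 < (if H.head b ∈ Y ∧ b ≠ e then x b else 0) →
          H.head b ∈ Y ∧ b ≠ e ∧ 0 < x b := by
        intro b hb
        by_cases hc : H.head b ∈ Y ∧ b ≠ e
        · rw [if_pos hc] at hb; exact ⟨hc.1, hc.2, hb⟩
        · rw [if_neg hc] at hb; exact absurd hb (lt_irrefl 0)
      obtain ⟨h1, h2, h3⟩ := hh a ha
      exact hs.out_unique a a' (hYZ (hYin a h3 h1 h2)) haa' h3 (hh a' ha').2.2)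
  have hP1 : ∀ s t, f'' s t ≠ 0 → ∀ a ∈ P'' s t, H.head a ∈ Y ∧ a ≠ e ∧ 0 < x a := by
    intro s t h0 a ha
    have hb := (hP s t h0).2 a ha
    by_cases hc : H.head a ∈ Y ∧ a ≠ e
    · rw [if_pos hc] at hb; exact ⟨hc.1, hc.2, hb⟩
    · rw [if_neg hc] at hb; exact absurd hb (lt_irrefl 0)
  have hP2 : ∀ s t, f' s t ≠ 0 → ∀ a ∈ P' s t, H.head a ∉ Y ∧ 0 < x a := by
    intro s t h0 a ha
    have hb := (h.walk s t h0).2 a ha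
    by_cases hc : H.head a ∈ Y
    · rw [if_pos hc] at hb; exact absurd hb (lt_irrefl 0)
    · rw [if_neg hc] at hb; exact ⟨hc, hb⟩
  have hf'Y : ∀ s ∈ Y, ∀ t, f' s t = 0 := by
    intro s hsY t
    have := h.sum_supply s
    rw [if_pos hsY] at this
    exact (sum_eq_zero_iff_of_nonneg fun t _ => h.nonneg s t).1 this t (mem_univ t)
  have hf''Y : ∀ s, s ∉ Y → ∀ t, f'' s t = 0 := by
    intro s hsY t
    have := hfs s
    rw [if_neg hsY] at this
    exact (sum_eq_zero_iff_of_nonneg fun t _ => hf s t).1 this t (mem_univ t)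
  have hf'0 : ∀ t, t ≠ t₀ → pos t ∈ Y → ∀ s, f' s t = 0 := by
    intro t ht htY s
    have := h.sum_demand t
    rw [if_neg ht, if_pos htY] at this
    exact (sum_eq_zero_iff_of_nonneg fun s _ => h.nonneg s t).1 this s (mem_univ s)
  have hpos0 : pos t₀ ∈ Y := ht₀ ▸ heY
  have hf''0 : ∀ t, pos t ∉ Y → ∀ s, f'' s t = 0 := by
    intro t htY s
    have ht : t ≠ t₀ := by rintro rfl; exact htY hpos0
    have := hft t
    rw [if_neg ht, if_neg htY] at this
    exact (sum_eq_zero_iff_of_nonneg fun s _ => hf s t).1 this s (mem_univ s)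
  obtain ⟨f, hfdef⟩ : ∃ f : W → T → ℝ, f = fun s t => f' s t + f'' s t := ⟨_, rfl⟩
  -- The supplies of the two routings are at disjoint sets of vertices, so there is still only one
  -- path per pair.
  obtain ⟨P, hPdef⟩ : ∃ P : W → T → List E, P = fun s t => if s ∈ Y then P'' s t else
    if t = t₀ then P' s t ++ [e] else P' s t := ⟨_, rfl⟩
  have hfnn : ∀ s t, 0 ≤ f s t := fun s t => by
    rw [hfdef]; exact add_nonneg (h.nonneg s t) (hf s t)
  have hterm : ∀ a s t, (if a ∈ P s t then f s t else 0)
      = (if a ∈ P' s t then f' s t else 0) + (if a ∈ P'' s t then f'' s t else 0)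
        + (if a = e ∧ t = t₀ then f' s t else 0) := by
    intro a s t
    by_cases hsY : s ∈ Y
    · simp [hPdef, hfdef, hsY, hf'Y s hsY]
    · simp only [hPdef, hfdef, hsY, hf''Y s hsY, if_false]
      by_cases ht : t = t₀
      · subst ht
        by_cases hae : a = e
        · subst hae
          by_cases h0 : f' s t = 0
          · simp [h0]
          · have : a ∉ P' s t := fun hm => (hP2 s t h0 a hm).1 heY
            simp [this]
        · simp [hae]
      · simp [ht]
  have hL : ∀ a t, arcLoad f P a t = arcLoad f' P' a t + arcLoad f'' P'' a t
      + (if a = e ∧ t = t₀ then x e else 0) := by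
    intro a t
    simp only [arcLoad, hterm, sum_add_distrib]
    congr 1
    by_cases hc : a = e ∧ t = t₀
    · simp only [hc, and_self, if_true]
      rw [h.sum_demand t₀, if_pos rfl]
    · simp [hc]
  have hL'0 : ∀ a t, H.head a ∈ Y → arcLoad f' P' a t = 0 := by
    intro a t ha
    by_contra h0
    obtain ⟨s, h1, h2⟩ := exists_of_arcLoad_ne_zero h0
    exact (hP2 s t h1 a h2).1 ha
  have hL''0 : ∀ a t, H.head a ∉ Y → arcLoad f'' P'' a t = 0 := by
    intro a t ha
    by_contra h0
    obtain ⟨s, h1, h2⟩ := exists_of_arcLoad_ne_zero h0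
    exact ha (hP1 s t h1 a h2).1
  have hL''e : ∀ t, arcLoad f'' P'' e t = 0 := by
    intro t
    by_contra h0
    obtain ⟨s, h1, h2⟩ := exists_of_arcLoad_ne_zero h0
    exact (hP1 s t h1 e h2).2.1 rfl
  -- arcs inside `Y`, the arc `e`, arcs outside
  have hLin : ∀ a t, H.head a ∈ Y → a ≠ e → arcLoad f P a t = arcLoad f'' P'' a t := by
    intro a t ha hae; rw [hL, hL'0 a t ha]; simp [hae]
  have hLe : ∀ t, arcLoad f P e t = if t = t₀ then x e else 0 := by
    intro t; rw [hL, hL'0 e t heY, hL''e]; simp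
  have hLout : ∀ a t, H.head a ∉ Y → arcLoad f P a t = arcLoad f' P' a t := by
    intro a t ha
    have hae : a ≠ e := by rintro rfl; exact ha heY
    rw [hL, hL''0 a t ha]; simp [hae]
  have hcol : ∀ a, arcLoad f' P' a t₀ ≠ 0 → κ a = κ e := by
    intro a ha
    obtain ⟨s, h1, has⟩ := exists_of_arcLoad_ne_zero ha
    have := (h.walk s t₀ h1).1
    rw [Function.update_self] at this
    exact this.color_of_tail_eq hκ has
  -- A terminal inside `Y` other than `t₀` prefers the colour of some arc with flow into its
  -- position; the default `κ e` occurs only if there is no such arc.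
  obtain ⟨p, hpdef⟩ : ∃ p : T → J, p = fun t => if t = t₀ then κ e else if pos t ∈ Y then
      (if hq : ∃ a, 0 < x a ∧ H.head a = pos t then κ hq.choose else κ e) else p' t := ⟨_, rfl⟩
  -- Inside `Y` amounts are counted by the colour of their walk. Flow that starts at the terminal
  -- itself has no colour and is credited to the preferred one; the `x e` units that reach `t₀` over
  -- `e` count for the colour of `e`.
  obtain ⟨g, hgdef⟩ : ∃ g : T → J → ℝ, g = fun t j => if pos t ∈ Y then
      (∑ s, if walkColor κ (p t) (P'' s t) = j then f'' s t else 0)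
        + (if t = t₀ ∧ j = κ e then x e else 0) else g' t j := ⟨_, rfl⟩
  have hgnn : ∀ t j, 0 ≤ g t j := by
    intro t j
    rw [hgdef]
    dsimp only
    split_ifs
    · exact add_nonneg (sum_nonneg fun s _ => by split_ifs <;> simp [hf]) he.le
    · exact add_nonneg (sum_nonneg fun s _ => by split_ifs <;> simp [hf]) le_rfl
    · exact h.color_nonneg t j
  have hdsum : ∀ t, (∑ s, f'' s t) + (if t = t₀ then x e else 0) = d t ∨ pos t ∉ Y := by
    intro t
    by_cases htY : pos t ∈ Y
    · left
      rw [hft t]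
      by_cases ht : t = t₀
      · subst ht; simp
      · simp [ht, htY]
    · exact Or.inr htY
  have hload'' : ∀ a t, H.head a ∈ Y → pos t ∈ Y → arcLoad f'' P'' a t
      ≤ ∑ s, if walkColor κ (p t) (P'' s t) = κ a then f'' s t else 0 := by
    intro a t _ _
    refine sum_le_sum fun s _ => ?_
    by_cases h0 : f'' s t = 0
    · simp [h0]
    by_cases ha : a ∈ P'' s t
    · rw [if_pos ha, if_pos ((hP s t h0).1.walkColor_eq hκ (p t) ha)]
    · rw [if_neg ha]; split_ifs <;> simp [hf]
  have hgY : ∀ t j, pos t ∈ Y → g t j = (∑ s, if walkColor κ (p t) (P'' s t) = j then f'' s t else 0)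
        + (if t = t₀ ∧ j = κ e then x e else 0) := by
    intro t j ht; rw [hgdef]; simp only [ht, if_true]
  have hgout : ∀ t j, pos t ∉ Y → g t j = g' t j := by
    intro t j ht; rw [hgdef]; simp only [ht, if_false]
  have hg'le : ∀ t j, g' t j ≤ if t = t₀ then x e else if pos t ∈ Y then 0 else d t := by
    intro t j
    rw [← h.sum_color t]
    exact single_le_sum (f := g' t) (fun j _ => h.color_nonneg t j) (mem_univ j)
  -- full demand at vertices with a single incoming colour
  have hgmono : ∀ a t, 0 < x a → H.head a ∈ Y → pos t = H.head a →
      (∀ b, 0 < x b → H.head b = H.head a → κ b = κ a) → g t (κ a) = d t := by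
    intro a t hxa haY hta hmono
    have htY : pos t ∈ Y := hta ▸ haY
    rw [hgY t _ htY]
    have hpt : p t = κ a := by
      rw [hpdef]
      dsimp only
      by_cases ht : t = t₀
      · subst ht
        rw [if_pos rfl]
        exact hmono e he (ht₀.symm.trans hta)
      · rw [if_neg ht, if_pos htY]
        have hq : ∃ a, 0 < x a ∧ H.head a = pos t := ⟨a, hxa, hta.symm⟩
        rw [dif_pos hq]
        exact hmono _ hq.choose_spec.1 (hq.choose_spec.2.trans hta)
    have h1 : (∑ s, if walkColor κ (p t) (P'' s t) = κ a then f'' s t else 0) = ∑ s, f'' s t := by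
      refine sum_congr rfl fun s _ => ?_
      by_cases h0 : f'' s t = 0
      · simp [h0]
      rw [if_pos]
      have hwk := (hP s t h0).1
      by_cases hnil : P'' s t = []
      · rw [hnil]; exact hpt
      · obtain ⟨b, hb, hbt⟩ := hwk.exists_head_eq hnil
        rw [hwk.walkColor_eq hκ (p t) hb]
        exact hmono b (hP1 s t h0 b hb).2.2 (hbt.trans hta)
    have h2 : (if t = t₀ ∧ κ a = κ e then x e else 0) = if t = t₀ then x e else 0 := by
      by_cases ht : t = t₀
      · subst ht
        simp [hmono e he (ht₀.symm.trans hta)]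
      · simp [ht]
    rw [h1, h2]
    exact (hdsum t).resolve_right (not_not.2 htY)
  have hL''le : ∀ a (S : Finset T), H.head a ∈ Y → a ≠ e →
      ∑ t ∈ S, arcLoad f'' P'' a t ≤ x a := by
    intro a S haY hae
    have h1 := hload a
    rw [if_pos ⟨haY, hae⟩] at h1
    exact (sum_le_sum_of_subset_of_nonneg (subset_univ S)
      fun t _ _ => arcLoad_nonneg hf a t).trans h1
  -- flow through a vertex of `Y` other than the root, to terminals elsewhere
  obtain ⟨B, hB⟩ : ∃ B, ∀ v, r v < B := ⟨(univ.sup r) + 1, fun v =>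
    Nat.lt_succ_of_le (le_sup (f := r) (mem_univ v))⟩
  -- On arcs inside the tree the load is at most `μ`, without a contribution of `x`. The induction
  -- goes downstream towards the root, `k` bounding the remaining increase of rank.
  have hR : ∀ k a, B ≤ r (H.head a) + k → 0 < x a → H.head a ∈ Y → a ≠ e →
      ∀ (S : Finset T) (μ : ℝ), 0 ≤ μ →
      (∀ t ∈ S, arcLoad f'' P'' a t ≠ 0 → g t (κ a) ≤ μ) →
      ∑ t ∈ S, arcLoad f'' P'' a t ≤ μ := by
    intro k
    induction k with
    | zero => intro a hBa; exact absurd (hB (H.head a)) (not_lt.2 (by simpa using hBa))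
    | succ k ih =>
      intro a hBa hxa haY hae S μ hμ hS
      have hposd : ∀ t, arcLoad f'' P'' a t ≠ 0 → 0 < d t ∧ pos t ∈ Y := by
        intro t h0
        have htY : pos t ∈ Y := by
          by_contra htY
          refine h0 (sum_eq_zero fun s _ => ?_)
          simp [hf''0 t htY s]
        refine ⟨?_, htY⟩
        have h1 := (hdsum t).resolve_right (not_not.2 htY)
        have h2 := arcLoad_le (P := P'') hf a t
        have h3 : 0 < arcLoad f'' P'' a t :=
          lt_of_le_of_ne (arcLoad_nonneg hf a t) (Ne.symm h0)
        have h4 : (0:ℝ) ≤ if t = t₀ then x e else 0 := by split_ifs <;> simp [he.le]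
        linarith
      have hloadg : ∀ t, arcLoad f'' P'' a t ≠ 0 → arcLoad f'' P'' a t ≤ g t (κ a) := by
        intro t h0
        have htY := (hposd t h0).2
        rw [hgY t _ htY]
        have := hload'' a t haY htY
        have h4 : (0:ℝ) ≤ if t = t₀ ∧ κ a = κ e then x e else 0 := by split_ifs <;> simp [he.le]
        linarith
      by_cases hroot : H.head a = H.head e
      · have hposw : ∀ t, arcLoad f'' P'' a t ≠ 0 → pos t = H.head a := by
          intro t h0
          obtain ⟨s, h1, h2⟩ := exists_of_arcLoad_ne_zero h0
          by_contra hne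
          obtain ⟨o, ho, ho'⟩ := (hP s t h1).1.exists_tail_eq_head h2 (Ne.symm hne)
          exact hw o (hP1 s t h1 o ho).2.2 (ho'.trans hroot)
        -- No flow passes through the root. If two terminals of `S` are served there, `le_max`
        -- bounds the entire arc by one of their demands; by `mono` only one colour enters, so both
        -- demands are received in this colour and are at most `μ`.
        by_cases htwo : ∃ t ∈ S, ∃ t' ∈ S, t ≠ t' ∧ arcLoad f'' P'' a t ≠ 0 ∧
            arcLoad f'' P'' a t' ≠ 0
        · obtain ⟨t, htS, t', htS', hne, h0, h0'⟩ := htwo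
          have hm := hs.le_max a t t' hxa (hYZ haY) (hposw t h0) (hposw t' h0') hne
            (hposd t h0).1 (hposd t' h0').1
          have hmono : ∀ b, 0 < x b → H.head b = H.head a → κ b = κ a := by
            intro b _ hb
            by_contra hne'
            exact hne (hs.mono b a t t' (hb.trans (hposw t h0).symm) (hposw t h0).symm
              ((hposw t' h0').trans (hposw t h0).symm) hne')
          have e1 := hgmono a t hxa haY (hposw t h0) hmono
          have e2 := hgmono a t' hxa haY (hposw t' h0') hmono
          have h1 := hS t htS h0
          have h2 := hS t' htS' h0'
          rw [e1] at h1
          rw [e2] at h2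
          exact (hL''le a S haY hae).trans (hm.trans (max_le h1 h2))
        · push Not at htwo
          by_cases hone : ∃ t ∈ S, arcLoad f'' P'' a t ≠ 0
          · obtain ⟨t, htS, h0⟩ := hone
            rw [sum_eq_single t]
            · exact (hloadg t h0).trans (hS t htS h0)
            · intro t' htS' hne
              by_contra h0'
              exact h0' (htwo t htS t' htS' hne.symm h0)
            · exact fun hn => absurd htS hn
          · push Not at hone
            rw [sum_eq_zero hone]
            exact hμ
      · obtain ⟨o, hxo, ho⟩ := hstep _ haY hroot
        have hoY : H.head o ∈ Y := hYout o hxo (ho ▸ haY)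
        have hoe : o ≠ e := by rintro rfl; exact hte (ho ▸ haY)
        -- If a terminal of `S` at this vertex is served, `le_demand` bounds the whole arc by its
        -- demand. Otherwise all relevant flow continues on the unique leaving arc `o`, which has
        -- the same colour.
        by_cases hhere : ∃ t ∈ S, pos t = H.head a ∧ arcLoad f'' P'' a t ≠ 0
        · obtain ⟨t, htS, hta, h0⟩ := hhere
          have h1 := hs.le_demand a o t hxa (hYZ haY) hta hxo ho (hposd t h0).1
          have e1 := hgmono a t hxa haY hta (fun b _ hb => by
            rw [hκ b o (hb.trans ho.symm), hκ a o ho.symm])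
          have h2 := hS t htS h0
          rw [e1] at h2
          exact (hL''le a S haY hae).trans (h1.trans h2)
        · push Not at hhere
          have hao : ∀ t ∈ S, arcLoad f'' P'' a t ≤
              if arcLoad f'' P'' a t ≠ 0 then arcLoad f'' P'' o t else 0 := by
            intro t htS
            split_ifs with h0
            · have hta : pos t ≠ H.head a := fun hh => h0 (hhere t htS hh)
              refine sum_le_sum fun s _ => ?_
              by_cases hz : f'' s t = 0
              · simp [hz]
              by_cases ha : a ∈ P'' s t
              · obtain ⟨o', ho', hoo⟩ := (hP s t hz).1.exists_tail_eq_head ha (Ne.symm hta)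
                have : o' = o := hs.out_unique o' o (hYZ (hoo ▸ haY)) (hoo.trans ho.symm)
                  (hP1 s t hz o' ho').2.2 hxo
                subst this
                rw [if_pos ha, if_pos ho']
              · rw [if_neg ha]; split_ifs <;> simp [hf]
            · simp only [not_not] at h0; exact h0.le
          refine (sum_le_sum hao).trans ?_
          rw [← sum_filter]
          refine ih o ?_ hxo hoY hoe _ μ hμ fun t ht _ => ?_
          · have := hr o
            rw [ho] at this
            omega
          · rw [mem_filter] at ht
            rw [← hκ a o ho.symm]
            exact hS t ht.1 ht.2
  refine ⟨f, P, p, g, hfnn, ?_, ?_, ?_, hgnn, ?_, ?_, ?_, ?_⟩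
  · intro s t hst
    by_cases hsY : s ∈ Y
    · have h0 : f'' s t ≠ 0 := by simpa [hfdef, hf'Y s hsY] using hst
      simp only [hPdef, hsY, if_true]
      exact ⟨(hP s t h0).1, fun a ha => (hP1 s t h0 a ha).2.2⟩
    · have h0 : f' s t ≠ 0 := by simpa [hfdef, hf''Y s hsY] using hst
      have h1 := (h.walk s t h0).1
      simp only [hPdef, hsY, if_false]
      by_cases ht : t = t₀
      · subst ht
        rw [Function.update_self] at h1
        simp only [if_true]
        refine ⟨ht₀ ▸ h1.append (isWalk_singleton e), fun a ha => ?_⟩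
        rcases List.mem_append.1 ha with ha | ha
        · exact (hP2 s t h0 a ha).2
        · rw [List.mem_singleton.1 ha]; exact he
      · rw [Function.update_of_ne ht] at h1
        simp only [ht, if_false]
        exact ⟨h1, fun a ha => (hP2 s t h0 a ha).2⟩
  · intro s
    simp only [hfdef, sum_add_distrib, h.sum_supply s, hfs s]
    split_ifs <;> simp
  · intro t
    simp only [hfdef, sum_add_distrib, h.sum_demand t, hft t]
    by_cases ht : t = t₀
    · subst ht; simp
    · by_cases htY : pos t ∈ Y <;> simp [ht, htY]
  · intro t
    by_cases htY : pos t ∈ Y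
    · simp only [hgY t _ htY, sum_add_distrib]
      rw [sum_comm]
      have h1 : (∑ j, if t = t₀ ∧ j = κ e then x e else 0) = if t = t₀ then x e else 0 := by
        by_cases ht : t = t₀ <;> simp [ht]
      rw [h1]
      simp only [sum_ite_eq, mem_univ, if_true]
      exact (hdsum t).resolve_right (not_not.2 htY)
    · simp only [hgout t _ htY]
      have ht : t ≠ t₀ := by rintro rfl; exact htY hpos0
      rw [h.sum_color t, if_neg ht, if_neg htY]
  · intro a t
    by_cases htY : pos t ∈ Y
    · rw [hgY t _ htY]
      have hnn : 0 ≤ ∑ s, if walkColor κ (p t) (P'' s t) = κ a then f'' s t else 0 :=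
        sum_nonneg fun s _ => by split_ifs <;> simp [hf]
      have h4 : (0:ℝ) ≤ if t = t₀ ∧ κ a = κ e then x e else 0 := by split_ifs <;> simp [he.le]
      by_cases haY : H.head a ∈ Y
      · by_cases hae : a = e
        · subst hae
          rw [hLe]
          simp only [and_true]
          linarith
        · rw [hLin a t haY hae]
          have := hload'' a t haY htY
          linarith
      · rw [hLout a t haY]
        by_cases h0 : arcLoad f' P' a t = 0
        · rw [h0]; exact add_nonneg hnn h4
        · by_cases ht : t = t₀
          · subst ht
            have h1 := (h.load_le_color a t).trans (hg'le t (κ a))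
            simp only [if_true] at h1
            simp only [hcol a h0, and_self, if_true]
            rw [hcol a h0] at hnn
            linarith
          · exfalso
            refine h0 (sum_eq_zero fun s _ => ?_)
            simp [hf'0 t ht htY s]
    · rw [hgout t _ htY]
      refine le_trans (le_of_eq ?_) (h.load_le_color a t)
      have ht : t ≠ t₀ := by rintro rfl; exact htY hpos0
      rw [hL]
      have : arcLoad f'' P'' a t = 0 := sum_eq_zero fun s _ => by simp [hf''0 t htY s]
      simp [this, ht]
  · intro a S μ hμ hS
    by_cases haY : H.head a ∈ Y
    · rw [if_pos (hYZ haY), zero_add]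
      by_cases hae : a = e
      · subst hae
        by_cases h0 : t₀ ∈ S
        · have h1 := hS t₀ h0 (by rw [hLe, if_pos rfl]; exact he.ne')
          rw [hgY t₀ _ hpos0] at h1
          have hnn : 0 ≤ ∑ s, if walkColor κ (p t₀) (P'' s t₀) = κ a then f'' s t₀ else 0 :=
            sum_nonneg fun s _ => by split_ifs <;> simp [hf]
          simp only [and_self, if_true] at h1
          simp only [hLe, sum_ite_eq', h0, if_true]
          linarith
        · simp only [hLe, sum_ite_eq', h0, if_false]
          exact hμ
      · simp only [hLin a _ haY hae] at hS ⊢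
        by_cases hxa : 0 < x a
        · exact hR B a (Nat.le_add_left B _) hxa haY hae S μ hμ hS
        · rw [sum_eq_zero]
          · exact hμ
          · intro t _
            by_contra h0
            obtain ⟨s, h1, h2⟩ := exists_of_arcLoad_ne_zero h0
            exact hxa (hP1 s t h1 a h2).2.2
    · simp only [hLout a _ haY] at hS ⊢
      have h1 := h.load_le a S μ hμ (fun t ht h0 => by
        have h2 := hS t ht h0
        by_cases htY : pos t ∈ Y
        · by_cases htt : t = t₀
          · subst htt
            rw [hgY t _ htY, hcol a h0] at h2
            have hnn : 0 ≤ ∑ s, if walkColor κ (p t) (P'' s t) = κ e then f'' s t else 0 :=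
              sum_nonneg fun s _ => by split_ifs <;> simp [hf]
            have h3 := hg'le t (κ a)
            simp only [and_self, if_true] at h2 h3
            linarith
          · exfalso
            refine h0 (sum_eq_zero fun s _ => ?_)
            simp [hf'0 t htt htY s]
        · rwa [hgout t _ htY] at h2)
      rwa [if_neg haY] at h1
  · intro a t t' h0 h0' hp hp'
    have hpt₀ : p t₀ = κ e := by rw [hpdef]; simp
    have hpout : ∀ t, pos t ∉ Y → p t = p' t := by
      intro t ht
      have : t ≠ t₀ := by rintro rfl; exact ht hpos0
      rw [hpdef]; simp [this, ht]
    by_cases haY : H.head a ∈ Y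
    · have hae : a ≠ e := by
        rintro rfl
        rw [hLe] at h0
        by_cases ht : t = t₀
        · subst ht; exact hp hpt₀
        · simp [ht] at h0
      -- A vertex with a leaving arc is entered in one colour only. Hence a terminal in `Y` served
      -- against its preference is at the root, and two colours enter there; then `mono` allows just
      -- one terminal.
      have key : ∀ t, arcLoad f P a t ≠ 0 → p t ≠ κ a → pos t = H.head e ∧
          ∃ b, H.head b = H.head e ∧ κ b ≠ κ e := by
        intro t h0 hp
        rw [hLin a t haY hae] at h0
        obtain ⟨s, h1, h2⟩ := exists_of_arcLoad_ne_zero h0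
        have hwk := (hP s t h1).1
        obtain ⟨b, hb, hbt⟩ := hwk.exists_head_eq (List.ne_nil_of_mem h2)
        obtain ⟨hbY, hbe, hxb⟩ := hP1 s t h1 b hb
        have hba : κ b = κ a := hwk.color_eq hκ hb h2
        have htY : pos t ∈ Y := hbt ▸ hbY
        have hcd : ∃ c, H.head c = pos t ∧ p t = κ c := by
          by_cases ht : t = t₀
          · subst ht; exact ⟨e, ht₀.symm, hpt₀⟩
          · have hq : ∃ a, 0 < x a ∧ H.head a = pos t := ⟨b, hxb, hbt⟩
            refine ⟨hq.choose, hq.choose_spec.2, ?_⟩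
            rw [hpdef]; simp only [ht, htY, if_true, if_false, dif_pos hq]
        obtain ⟨c, hc, hpc⟩ := hcd
        have hcb : κ c ≠ κ b := by rw [← hpc, hba]; exact hp
        have hroot : pos t = H.head e := by
          by_contra hne
          obtain ⟨o, _, ho⟩ := hstep _ htY hne
          exact hcb (by rw [hκ c o (hc.trans ho.symm), hκ b o (hbt.trans ho.symm)])
        refine ⟨hroot, ?_⟩
        by_cases hbe' : κ b = κ e
        · exact ⟨c, hc.trans hroot, by rw [← hbe']; exact hcb⟩
        · exact ⟨b, hbt.trans hroot, hbe'⟩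
      obtain ⟨h1, b, hb, hbe⟩ := key t h0 hp
      obtain ⟨h1', -⟩ := key t' h0' hp'
      exact hs.mono b e t t' (hb.trans h1.symm) h1.symm (h1'.trans h1.symm) hbe
    · have key : ∀ t, arcLoad f P a t ≠ 0 → p t ≠ κ a → pos t ∉ Y := by
        intro t h0 hp htY
        rw [hLout a t haY] at h0
        by_cases ht : t = t₀
        · subst ht
          exact hp (hpt₀.trans (hcol a h0).symm)
        · refine h0 (sum_eq_zero fun s _ => ?_)
          simp [hf'0 t ht htY s]
      have k1 := key t h0 hp
      have k2 := key t' h0' hp'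
      rw [hLout a t haY] at h0
      rw [hLout a t' haY] at h0'
      rw [hpout t k1] at hp
      rw [hpout t' k2] at hp'
      exact h.unique a t t' h0 h0' hp hp'

end ArcDigraph

end

/-! ### Circulations that increase flow only on arcs into `Z` -/

noncomputable section

namespace ArcDigraph

open scoped Classical

variable {W E T J : Type*}

/-- `x` leaves `v` on at least two arcs. -/
def IsBranch (H : ArcDigraph W E) (x : E → ℝ) (v : W) : Prop :=
  ∃ a a', a ≠ a' ∧ 0 < x a ∧ 0 < x a' ∧ H.tail a = v ∧ H.tail a' = v

/-- `x` does not leave `v`. -/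
def IsEnd (H : ArcDigraph W E) (x : E → ℝ) (v : W) : Prop := ∀ a, 0 < x a → H.tail a ≠ v

/-- Adjacency in the support of `x`. -/
def Step (H : ArcDigraph W E) (x : E → ℝ) (u v : W) : Prop :=
  ∃ a, 0 < x a ∧ H.tail a = u ∧ H.head a = v

/-- Some branching vertex reaches `v`. -/
def IsLive (H : ArcDigraph W E) (x : E → ℝ) (v : W) : Prop :=
  ∃ u, H.IsBranch x u ∧ Relation.ReflTransGen (H.Step x) u v

theorem eq_of_not_isBranch {H : ArcDigraph W E} {x : E → ℝ} {v : W} (h : ¬ H.IsBranch x v) {a a' : E}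
    (ha : 0 < x a) (ha' : 0 < x a') (hv : H.tail a = v) (hv' : H.tail a' = v) : a = a' := by
  by_contra hne
  exact h ⟨a, a', hne, ha, ha', hv, hv'⟩

/-- Trace backwards from `e`: a tail that does not branch lies in `Z` and, being live, is entered by
an arc whose tail is live again. The rank drops, so a branching vertex is met eventually. -/
theorem exists_trace {H : ArcDigraph W E} (r : W → ℕ) (hr : ∀ a, r (H.tail a) < r (H.head a))
    {x : E → ℝ} {Z : Set W}
    (hZ : ∀ a, 0 < x a → H.head a ∈ Z → ¬ H.IsBranch x (H.tail a) → H.tail a ∈ Z) {e : E}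
    (he : 0 < x e) (heZ : H.head e ∈ Z) (hl : H.IsLive x (H.tail e)) :
    ∃ l v, l.getLast? = some e ∧ H.IsWalk v (H.head e) l ∧ H.IsBranch x v ∧
      ∀ a ∈ l, 0 < x a ∧ H.head a ∈ Z := by
  obtain ⟨k, hk⟩ : ∃ k, k = r (H.tail e) := ⟨_, rfl⟩
  induction k using Nat.strong_induction_on generalizing e with
  | _ k ih =>
  by_cases hb : H.IsBranch x (H.tail e)
  · exact ⟨[e], H.tail e, rfl, isWalk_singleton e, hb, by simp [he, heZ]⟩
  · obtain ⟨u, hu, hreach⟩ := hl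
    rcases hreach.cases_tail with rfl | ⟨y, hy, a, ha, hay, hae⟩
    · exact absurd hu hb
    · have h1 := hZ e he heZ hb
      obtain ⟨l, v, -, hw, hv, hpos⟩ := ih (r (H.tail a)) (by rw [hk, ← hae]; exact hr a) ha
        (hae ▸ h1) ⟨u, hu, hay ▸ hy⟩ rfl
      refine ⟨l ++ [e], v, by simp, (hae ▸ hw).append (isWalk_singleton e), hv, fun b hb => ?_⟩
      rcases List.mem_append.1 hb with hb | hb
      · exact hpos b hb
      · rw [List.mem_singleton.1 hb]; exact ⟨he, heZ⟩

/-- Within `Z` the flow can be continued in only one way, so both walks follow the same arcs until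
the flow ends. -/
theorem IsWalk.eq_of_isEnd {H : ArcDigraph W E} {x : E → ℝ} {Z : Set W}
    (hout : ∀ a a', H.tail a ∈ Z → H.tail a = H.tail a' → 0 < x a → 0 < x a' → a = a')
    {u w w' : W} {l l' : List E} (hl : H.IsWalk u w l) (hl' : H.IsWalk u w' l')
    (hw : H.IsEnd x w) (hw' : H.IsEnd x w') (hu : u ∈ Z) (hpos : ∀ a ∈ l, 0 < x a ∧ H.head a ∈ Z)
    (hpos' : ∀ a ∈ l', 0 < x a) : l = l' := by
  induction l generalizing u l' with
  | nil =>
    cases hl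
    cases l' with
    | nil => rfl
    | cons b l' => exact absurd hl'.1 (hw b (hpos' b (by simp)))
  | cons a l ih =>
    cases l' with
    | nil =>
      cases hl'
      exact absurd hl.1 (hw' a (hpos a (by simp)).1)
    | cons b l' =>
      have hab : a = b := hout a b (hl.1 ▸ hu) (hl.1.trans hl'.1.symm) (hpos a (by simp)).1
        (hpos' b (by simp))
      subst hab
      rw [ih hl.2 hl'.2 (hpos a (by simp)).2 (fun c hc => hpos c (by simp [hc]))
        fun c hc => hpos' c (by simp [hc])]

/-- If every vertex where the flow ends is entered by two arcs that can be traced back to branching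
vertices, then there is a circulation in the support of the flow that is positive only on arcs into
`Z`. -/
theorem exists_alternating_circulation [Fintype W] [Fintype E] (H : ArcDigraph W E) (r : W → ℕ)
    (hr : ∀ a, r (H.tail a) < r (H.head a)) (x : E → ℝ) (Z : Set W)
    (hout : ∀ a a', H.tail a ∈ Z → H.tail a = H.tail a' → 0 < x a → 0 < x a' → a = a')
    (hend : ∀ v, H.IsEnd x v → v ∈ Z)
    (hZ : ∀ a, 0 < x a → H.head a ∈ Z → ¬ H.IsBranch x (H.tail a) → H.tail a ∈ Z)
    (hlive : ∀ a, 0 < x a → H.IsEnd x (H.head a) → ∃ e e', e ≠ e' ∧ 0 < x e ∧ 0 < x e' ∧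
      H.head e = H.head a ∧ H.head e' = H.head a ∧ H.IsLive x (H.tail e) ∧ H.IsLive x (H.tail e'))
    (hne : ∃ a, 0 < x a) :
    ∃ δ : E → ℝ, (∀ v, H.net δ v = 0) ∧ (∀ a, δ a ≠ 0 → 0 < x a) ∧
      (∀ a, 0 < δ a → H.head a ∈ Z) ∧ ∃ a, 0 < δ a := by
  obtain ⟨e₀, he₀⟩ := hne
  let S := {w : W // H.IsEnd x w ∧ ∃ a, 0 < x a ∧ H.head a = w}
  let U := {v : W // H.IsBranch x v}
  let Good : W → E → Prop := fun w a => H.IsBranch x (H.tail a) ∧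
    ∃ l, H.IsWalk (H.tail a) w (a :: l) ∧ ∀ b ∈ a :: l, 0 < x b ∧ H.head b ∈ Z
  -- Hall's theorem is applied to the ends of the flow and the branching vertices together. An end
  -- may choose among arcs that leave a branching vertex and start a walk through `Z` to it, a
  -- branching vertex among its leaving arcs. Every set has at least two arcs, and every arc is in
  -- at most one set of either kind, so double counting gives Hall's condition.
  let F : S ⊕ U → Finset E :=
    Sum.elim (fun w => univ.filter (Good w.1)) (fun v => univ.filter fun a => 0 < x a ∧ H.tail a = v.1)
  have hGood : ∀ (w w' : S) (a : E), Good w.1 a → Good w'.1 a → w = w' := by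
    rintro ⟨w, hw, _⟩ ⟨w', hw', _⟩ a ⟨_, l, hl, hp⟩ ⟨_, l', hl', hp'⟩
    have : l = l' := IsWalk.eq_of_isEnd hout hl.2 hl'.2 hw hw' (hp a (by simp)).2
      (fun c hc => hp c (by simp [hc])) fun c hc => (hp' c (by simp [hc])).1
    subst this
    have h1 := hl.net_count w
    have h2 := hl'.net_count w
    apply Subtype.ext
    by_contra hww
    rw [h1] at h2
    simp [Ne.symm hww] at h2
  have htwo : ∀ i, 2 ≤ #(F i) := by
    rintro (⟨w, hw, a, ha, rfl⟩ | ⟨v, a, a', hne, ha, ha', hv, hv'⟩)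
    · obtain ⟨e, e', hne, he, he', hea, hea', hl, hl'⟩ := hlive a ha hw
      have hwZ := hend _ hw
      obtain ⟨l, v, hlast, hwk, hb, hp⟩ := exists_trace r hr hZ he (hea ▸ hwZ) hl
      obtain ⟨l', v', hlast', hwk', hb', hp'⟩ := exists_trace r hr hZ he' (hea' ▸ hwZ) hl'
      cases l with
      | nil => simp at hlast
      | cons b l =>
      cases l' with
      | nil => simp at hlast'
      | cons b' l' =>
      have hbt : H.tail b = v := hwk.1
      have hbt' : H.tail b' = v' := hwk'.1
      subst hbt hbt'
      have hbb : b ≠ b' := by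
        rintro rfl
        have : l = l' := IsWalk.eq_of_isEnd hout hwk.2 hwk'.2 (hea ▸ hw) (hea' ▸ hw)
          (hp b (by simp)).2 (fun c hc => hp c (by simp [hc])) fun c hc => (hp' c (by simp [hc])).1
        subst this
        rw [hlast] at hlast'
        exact hne (Option.some.inj hlast')
      refine one_lt_card.2 ⟨b, ?_, b', ?_, hbb⟩
      · simp only [F, Sum.elim_inl, mem_filter, mem_univ, true_and]
        exact ⟨hb, l, hea ▸ hwk, hp⟩
      · simp only [F, Sum.elim_inl, mem_filter, mem_univ, true_and]
        exact ⟨hb', l', hea' ▸ hwk', hp'⟩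
    · refine one_lt_card.2 ⟨a, ?_, a', ?_, hne⟩
      · simp [F, ha, hv]
      · simp [F, ha', hv']
  obtain ⟨φ, hφinj, hφ⟩ := (all_card_le_biUnion_card_iff_exists_injective F).1 (by
    intro s
    have := card_mul_le_card_mul (s := s) (t := s.biUnion F) (fun i a => a ∈ F i) (m := 2) (n := 2)
      (fun i hi => (htwo i).trans (card_le_card fun a ha => by
        rw [mem_bipartiteAbove]
        exact ⟨mem_biUnion.2 ⟨i, hi, ha⟩, ha⟩))
      (fun a _ => by
        have : #(univ : Finset Bool) = 2 := rfl
        rw [← this]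
        refine card_le_card_of_injOn Sum.isLeft (fun _ _ => mem_coe.2 (mem_univ _)) ?_
        rintro (w | v) h1 (w' | v') h2 hh
        · have g1 := (mem_bipartiteBelow _).1 (mem_coe.1 h1)
          have g2 := (mem_bipartiteBelow _).1 (mem_coe.1 h2)
          simp only [F, Sum.elim_inl, mem_filter, mem_univ, true_and] at g1 g2
          rw [hGood w w' a g1.2 g2.2]
        · simp at hh
        · simp at hh
        · have g1 := (mem_bipartiteBelow _).1 (mem_coe.1 h1)
          have g2 := (mem_bipartiteBelow _).1 (mem_coe.1 h2)
          simp only [F, Sum.elim_inr, mem_filter, mem_univ, true_and] at g1 g2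
          rw [Subtype.ext (g1.2.2.symm.trans g2.2.2)])
    omega)
  -- a distinguished arc out of each vertex
  obtain ⟨n, hn, hnb⟩ : ∃ n : W → E, (∀ v, ¬ H.IsEnd x v → 0 < x (n v) ∧ H.tail (n v) = v) ∧
      ∀ v : U, n v.1 = φ (Sum.inr v) := by
    refine ⟨fun v => if h : H.IsBranch x v then φ (Sum.inr ⟨v, h⟩) else
      if h' : ∃ a, 0 < x a ∧ H.tail a = v then h'.choose else e₀, fun v hv => ?_, fun v => ?_⟩
    · by_cases h : H.IsBranch x v
      · have := hφ (Sum.inr ⟨v, h⟩)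
        simp only [F, Sum.elim_inr, mem_filter, mem_univ, true_and] at this
        simpa only [h, dif_pos] using this
      · have h' : ∃ a, 0 < x a ∧ H.tail a = v := by
          simp only [IsEnd, not_forall, not_not] at hv
          obtain ⟨a, ha, hav⟩ := hv
          exact ⟨a, ha, hav⟩
        simpa only [h, h', dif_pos, dif_neg, not_false_eq_true] using h'.choose_spec
    · exact dif_pos v.2
  obtain ⟨B, hB⟩ : ∃ B, ∀ v, r v < B := ⟨(univ.sup r) + 1, fun v =>
    Nat.lt_succ_of_le (le_sup (f := r) (mem_univ v))⟩
  have hfw : ∀ k v, B ≤ r v + k → ∃ l w, H.IsWalk v w l ∧ H.IsEnd x w ∧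
      ∀ a ∈ l, 0 < x a ∧ a = n (H.tail a) := by
    intro k
    induction k with
    | zero => intro v hv; exact absurd (hB v) (not_lt.2 (by simpa using hv))
    | succ k ih =>
      intro v hv
      by_cases h : H.IsEnd x v
      · exact ⟨[], v, rfl, h, by simp⟩
      · obtain ⟨h1, h2⟩ := hn v h
        obtain ⟨l, w, hw, he, hl⟩ := ih (H.head (n v)) (by have := hr (n v); rw [h2] at this; omega)
        refine ⟨n v :: l, w, ⟨h2, hw⟩, he, fun a ha => ?_⟩
        rcases List.mem_cons.1 ha with rfl | ha
        · exact ⟨h1, by rw [h2]⟩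
        · exact hl a ha
  have hfwS : ∀ v, ¬ H.IsEnd x v → ∃ (l : List E) (w : S), H.IsWalk v w.1 l ∧
      ∀ a ∈ l, 0 < x a ∧ a = n (H.tail a) := by
    intro v hv
    obtain ⟨l, w, hw, he, hl⟩ := hfw B v (Nat.le_add_left B _)
    have hnil : l ≠ [] := by rintro rfl; cases hw; exact hv he
    obtain ⟨a, ha, haw⟩ := hw.exists_head_eq hnil
    exact ⟨l, ⟨w, he, a, (hl a ha).1, haw⟩, hw, hl⟩
  -- From an end `w`, go back along the walk that starts with the representative of `w`, then
  -- forward along distinguished arcs to an end `w'`. The first arc of the backward part is not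
  -- distinguished, because representatives are distinct.
  have hstep : ∀ w : S, ∃ (w' : S) (l l' : List E) (a : E) (v : W), a ∈ l ∧ a ∉ l' ∧
      H.IsWalk v w.1 l ∧ H.IsWalk v w'.1 l' ∧ (∀ b ∈ l, 0 < x b ∧ H.head b ∈ Z) ∧
      (∀ b ∈ l', 0 < x b ∧ b = n (H.tail b)) ∧ a = φ (Sum.inl w) := by
    intro w
    have h1 := hφ (Sum.inl w)
    simp only [F, Sum.elim_inl, mem_filter, mem_univ, true_and] at h1
    obtain ⟨hb, l, hl, hp⟩ := h1
    obtain ⟨l', w', hl', hp'⟩ := hfwS (H.tail (φ (Sum.inl w)))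
      fun h => h _ (hp _ (by simp)).1 rfl
    refine ⟨w', _, l', φ (Sum.inl w), _, by simp, fun hmem => ?_, hl, hl', hp, hp', rfl⟩
    have h2 := (hp' _ hmem).2
    rw [hnb ⟨_, hb⟩] at h2
    exact absurd (hφinj h2) (by simp)
  choose nx L L' arc st hL hL' hwk hwk' hpL hpL' harc using hstep
  obtain ⟨-, w₀, -, -⟩ := hfwS (H.tail e₀) fun h => h e₀ he₀ rfl
  -- There are finitely many ends, so the sequence of ends repeats. Between two repetitions the net
  -- outflows telescope to zero.
  obtain ⟨i, j, hij, heq⟩ : ∃ i j, i < j ∧ nx^[i] w₀ = nx^[j] w₀ := by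
    obtain ⟨i, j, hne, h⟩ := Finite.exists_ne_map_eq_of_infinite fun k : ℕ => nx^[k] w₀
    rcases lt_or_gt_of_ne hne with h' | h'
    · exact ⟨i, j, h', h⟩
    · exact ⟨j, i, h', h.symm⟩
  obtain ⟨q, hq⟩ : ∃ q : ℕ → S, q = fun k => nx^[i + k] w₀ := ⟨_, rfl⟩
  have hq1 : ∀ k, q (k + 1) = nx (q k) := fun k => by
    rw [hq]
    exact Function.iterate_succ_apply' nx (i + k) w₀
  have hq2 : q (j - i) = q 0 := by
    rw [hq]
    dsimp only
    rw [Nat.add_sub_cancel' hij.le, add_zero, heq]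
  refine ⟨fun a => ∑ k ∈ range (j - i),
    (((L (q k)).count a : ℝ) + (-1) * ((L' (q k)).count a : ℝ)), fun v => ?_, fun a ha => ?_,
    fun a ha => ?_, arc (q 0), ?_⟩
  · rw [net_sum]
    have : ∀ k, H.net (fun a => ((L (q k)).count a : ℝ) + (-1) * ((L' (q k)).count a : ℝ)) v
        = (if (q (k + 1)).1 = v then 1 else 0) - if (q k).1 = v then 1 else 0 := by
      intro k
      rw [net_add, net_smul, (hwk _).net_count, (hwk' _).net_count, hq1]
      ring
    simp only [this]
    rw [sum_range_sub (fun k => if (q k).1 = v then (1:ℝ) else 0), hq2, sub_self]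
  · obtain ⟨k, -, hk⟩ := exists_ne_zero_of_sum_ne_zero ha
    by_cases h1 : a ∈ L (q k)
    · exact (hpL _ a h1).1
    · by_cases h2 : a ∈ L' (q k)
      · exact (hpL' _ a h2).1
      · simp [List.count_eq_zero_of_not_mem h1, List.count_eq_zero_of_not_mem h2] at hk
  · obtain ⟨k, -, hk⟩ := exists_lt_of_sum_lt (s := range (j - i)) (f := fun _ => (0:ℝ))
      (by simpa using ha)
    by_cases h1 : a ∈ L (q k)
    · exact (hpL _ a h1).2
    · rw [List.count_eq_zero_of_not_mem h1] at hk
      have : (0:ℝ) ≤ (L' (q k)).count a := Nat.cast_nonneg _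
      simp at hk
      linarith
  -- This arc lies on a walk counted positively and, not being distinguished, on none counted
  -- negatively, so it cannot cancel.
  · have hn' : ∀ k, arc (q 0) ∉ L' (q k) := by
      intro k hmem
      have h1 := (hpL' _ _ hmem).2
      have h2 := hφ (Sum.inl (q 0))
      simp only [F, Sum.elim_inl, mem_filter, mem_univ, true_and] at h2
      rw [harc, hnb ⟨_, h2.1⟩] at h1
      exact absurd (hφinj h1) (by simp)
    simp only [List.count_eq_zero_of_not_mem (hn' _)]
    refine sum_pos' (fun k _ => by simp) ⟨0, by simp; omega, ?_⟩
    have : 0 < (L (q 0)).count (arc (q 0)) := List.count_pos_iff.2 (hL _)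
    simpa using this

/-- A nonzero circulation on an acyclic digraph is negative somewhere. -/
theorem exists_neg_of_net_eq_zero [Fintype W] [Fintype E] (H : ArcDigraph W E) (r : W → ℕ)
    (hr : ∀ a, r (H.tail a) < r (H.head a)) (δ : E → ℝ) (hδ : ∀ v, H.net δ v = 0)
    (hpos : ∃ a, 0 < δ a) : ∃ a, δ a < 0 := by
  by_contra! hn
  obtain ⟨e, he⟩ := hpos
  -- Weight the balance at each vertex by its rank: the sum becomes that of `(r (tail a) - r (head
  -- a)) * δ a`, which would be negative if `δ` were nonnegative and nonzero.
  have h1 : ∀ q : E → W, (∑ v, (r v : ℝ) * ∑ a, if q a = v then δ a else 0)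
      = ∑ a, (r (q a) : ℝ) * δ a := by
    intro q
    simp only [mul_sum, mul_ite, mul_zero]
    rw [sum_comm]
    simp
  have h2 : ∑ a, ((r (H.tail a) : ℝ) * δ a - r (H.head a) * δ a) = 0 := by
    rw [sum_sub_distrib, ← h1, ← h1, ← sum_sub_distrib]
    refine sum_eq_zero fun v _ => ?_
    rw [← mul_sub]
    have := hδ v
    unfold net at this
    rw [this, mul_zero]
  have h3 : ∑ a, ((r (H.tail a) : ℝ) * δ a - r (H.head a) * δ a) < 0 := by
    refine sum_neg' (fun a _ => ?_) ⟨e, mem_univ e, ?_⟩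
    · have : (r (H.tail a) : ℝ) < r (H.head a) := by exact_mod_cast hr a
      nlinarith [hn a]
    · have : (r (H.tail e) : ℝ) < r (H.head e) := by exact_mod_cast hr e
      nlinarith
  linarith

end ArcDigraph

end

/-! ### Every state is routable -/

noncomputable section

namespace ArcDigraph

open scoped Classical

variable {W E T J : Type*}

section

variable [Fintype W] [Fintype T] [Fintype J] {H : ArcDigraph W E} {κ : E → J}
  {x : E → ℝ} {σ : W → ℝ} {pos : T → W} {d : T → ℝ} {Z : Set W}

/-- The flow enters the notion of a routing only through its support and through the load bound off
`Z`. This transfers routings back from an enlarged `Z` and from an augmented flow, which has grown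
only on arcs into `Z`. -/
theorem Routable.mono {x' : E → ℝ} {Z' : Set W} (h : Routable H κ x' σ pos d Z')
    (hsupp : ∀ a, 0 < x' a → 0 < x a)
    (hle : ∀ a, (if H.head a ∈ Z' then 0 else x' a) ≤ if H.head a ∈ Z then 0 else x a) :
    Routable H κ x σ pos d Z := by
  obtain ⟨f, P, p, g, h⟩ := h
  exact ⟨f, P, p, g, h.nonneg,
    fun s t hst => ⟨(h.walk s t hst).1, fun a ha => hsupp a ((h.walk s t hst).2 a ha)⟩,
    h.sum_supply, h.sum_demand, h.color_nonneg, h.sum_color, h.load_le_color,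
    fun a S μ hμ hS => (h.load_le a S μ hμ hS).trans (by have := hle a; linarith), h.unique⟩

end

section

variable [Fintype E] [Fintype T] {H : ArcDigraph W E} {κ : E → J}
  {x : E → ℝ} {σ : W → ℝ} {pos : T → W} {d : T → ℝ} {Z : Set W}

/-- All arcs into the tail of `e` share the colour of `e`, so the condition is void at the new
position of `t₀`; anywhere else it is inherited. -/
theorem IsState.mono_update (hκ : ∀ a a', H.head a = H.tail a' → κ a = κ a')
    (hs : IsState H κ x σ pos d Z) (e : E) (t₀ : T) (a a' : E) (t t' : T)
    (ha : H.head a = Function.update pos t₀ (H.tail e) t)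
    (ha' : H.head a' = Function.update pos t₀ (H.tail e) t)
    (htt : Function.update pos t₀ (H.tail e) t' = Function.update pos t₀ (H.tail e) t)
    (hne : κ a ≠ κ a') : t = t' := by
  by_cases hu : Function.update pos t₀ (H.tail e) t = H.tail e
  · exact absurd ((hκ a e (ha.trans hu)).trans (hκ a' e (ha'.trans hu)).symm) hne
  · have h1 : t ≠ t₀ := by rintro rfl; exact hu (Function.update_self ..)
    have h2 : t' ≠ t₀ := by rintro rfl; exact hu (htt ▸ Function.update_self ..)
    rw [Function.update_of_ne h1] at ha ha' htt
    rw [Function.update_of_ne h2] at htt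
    exact hs.mono a a' t t' ha ha' htt hne

/-- The only new conditions concern `t₀` at the tail of `e`. Together with another terminal there,
`le_max` follows from the old `le_demand` of that terminal, because flow left on `e`. If the tail is
in `Z`, so is the head; the move then uses up `e`, the only leaving arc, and `le_demand` for `t₀` is
void. -/
theorem IsState.move (hκ : ∀ a a', H.head a = H.tail a' → κ a = κ a')
    (hs : IsState H κ x σ pos d Z) {e : E} {t₀ : T} (he : H.head e = pos t₀) (hd0 : 0 < d t₀)
    (hle : d t₀ ≤ x e) (hZ : H.head e ∈ Z → x e = d t₀) :
    IsState H κ (Function.update x e (x e - d t₀)) σ (Function.update pos t₀ (H.tail e)) d Z := by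
  have hxe : ∀ a, Function.update x e (x e - d t₀) a ≤ x a := fun a => by
    by_cases hae : a = e
    · subst hae; simp [hd0.le]
    · simp [hae]
  have hxe' : ∀ a, 0 < Function.update x e (x e - d t₀) a → 0 < x a :=
    fun a ha => ha.trans_le (hxe a)
  have he0 : 0 < x e := hd0.trans_le hle
  have hnew : ∀ a t', 0 < x a → H.head a ∈ Z → H.head a = H.tail e → t' ≠ t₀ →
      Function.update pos t₀ (H.tail e) t' = H.head a → 0 < d t' → x a ≤ d t' := by
    intro a t' ha haZ hau ht' hpt hdt
    rw [Function.update_of_ne ht'] at hpt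
    exact hs.le_demand a e t' ha haZ hpt he0 hau.symm hdt
  refine ⟨fun a => ?_, hs.supply_nonneg, hs.demand_nonneg, fun v => ?_, hs.mono_update hκ e t₀,
    fun a a' h1 h2 h3 h4 => hs.out_unique a a' h1 h2 (hxe' a h3) (hxe' a' h4),
    fun a h1 h2 => hs.closed a (hxe' a h1) h2, ?_, ?_⟩
  · by_cases hae : a = e
    · subst hae; simp [hle]
    · simpa [hae] using hs.x_nonneg a
  · have h1 : (∑ t, if Function.update pos t₀ (H.tail e) t = v then d t else 0)
        = (∑ t, if pos t = v then d t else 0) + ((if H.tail e = v then d t₀ else 0)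
          - if pos t₀ = v then d t₀ else 0) := by
      rw [show ((if H.tail e = v then d t₀ else 0) - if pos t₀ = v then d t₀ else 0)
        = ∑ t, if t = t₀ then ((if H.tail e = v then d t₀ else 0)
          - if pos t₀ = v then d t₀ else 0) else 0 by simp, ← sum_add_distrib]
      refine sum_congr rfl fun t _ => ?_
      by_cases ht : t = t₀
      · subst ht; simp
      · simp [ht]
    rw [net_update, hs.balance v, h1, he]
    split_ifs <;> ring
  · intro a t t' ha haZ hpt hpt' hne hdt hdt'
    have ha' := hxe' a ha
    refine (hxe a).trans ?_
    by_cases ht : t = t₀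
    · have hau : H.head a = H.tail e := by rw [← hpt, ht, Function.update_self]
      exact (hnew a t' ha' haZ hau (ht ▸ hne.symm) hpt' hdt').trans (le_max_right _ _)
    · by_cases ht' : t' = t₀
      · have hau : H.head a = H.tail e := by rw [← hpt', ht', Function.update_self]
        exact (hnew a t ha' haZ hau ht hpt hdt).trans (le_max_left _ _)
      · rw [Function.update_of_ne ht] at hpt
        rw [Function.update_of_ne ht'] at hpt'
        exact hs.le_max a t t' ha' haZ hpt hpt' hne hdt hdt'
  · intro a o t ha haZ hpt ho hto hdt
    have ha' := hxe' a ha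
    by_cases ht : t = t₀
    · have hau : H.head a = H.tail e := by rw [← hpt, ht, Function.update_self]
      have hoe : o = e := hs.out_unique o e (hto ▸ haZ) (hto.trans hau) (hxe' o ho) he0
      subst hoe
      have := hZ (hs.closed o he0 (hau ▸ haZ))
      rw [Function.update_self, this, sub_self] at ho
      exact absurd ho (lt_irrefl 0)
    · rw [Function.update_of_ne ht] at hpt
      exact (hxe a).trans (hs.le_demand a o t ha' haZ hpt (hxe' o ho) hto hdt)

/-- As for a single move: arcs into the tail of `e` are bounded by the old `le_demand` through `e`,
and the new flow vanishes on `e`, because its head is in `Y`. -/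
theorem IsState.outside (hκ : ∀ a a', H.head a = H.tail a' → κ a = κ a')
    (hs : IsState H κ x σ pos d Z) {Y : Set W} {e : E} {t₀ : T} (he : 0 < x e)
    (heY : H.head e ∈ Y) (hte : H.tail e ∉ Y) (ht₀ : pos t₀ = H.head e)
    (hYin : ∀ a, 0 < x a → H.head a ∈ Y → a ≠ e → H.tail a ∈ Y)
    (hYout : ∀ a, 0 < x a → H.tail a ∈ Y → H.head a ∈ Y) :
    IsState H κ (fun a => if H.head a ∈ Y then 0 else x a) (fun v => if v ∈ Y then 0 else σ v)
      (Function.update pos t₀ (H.tail e))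
      (fun t => if t = t₀ then x e else if pos t ∈ Y then 0 else d t) Z := by
  have hx' : ∀ a, 0 < (if H.head a ∈ Y then 0 else x a) → H.head a ∉ Y ∧ 0 < x a := by
    intro a ha
    by_cases hc : H.head a ∈ Y
    · rw [if_pos hc] at ha; exact absurd ha (lt_irrefl 0)
    · rw [if_neg hc] at ha; exact ⟨hc, ha⟩
  have hd' : ∀ t, t ≠ t₀ → 0 < (if t = t₀ then x e else if pos t ∈ Y then 0 else d t) →
      (if t = t₀ then x e else if pos t ∈ Y then 0 else d t) = d t := by
    intro t ht h
    rw [if_neg ht] at h ⊢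
    by_cases hc : pos t ∈ Y
    · rw [if_pos hc] at h; exact absurd h (lt_irrefl 0)
    · rw [if_neg hc]
  have hnew : ∀ a t', 0 < x a → H.head a ∈ Z → H.head a = H.tail e → t' ≠ t₀ →
      Function.update pos t₀ (H.tail e) t' = H.head a →
      0 < (if t' = t₀ then x e else if pos t' ∈ Y then 0 else d t') →
      x a ≤ (if t' = t₀ then x e else if pos t' ∈ Y then 0 else d t') := by
    intro a t' ha haZ hau ht' hpt hdt
    rw [Function.update_of_ne ht'] at hpt
    have e1 := hd' t' ht' hdt
    rw [e1] at hdt ⊢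
    exact hs.le_demand a e t' ha haZ hpt he hau.symm hdt
  refine ⟨fun a => ?_, fun v => ?_, fun t => ?_, hs.balance_outside heY hte ht₀ hYin hYout,
    hs.mono_update hκ e t₀,
    fun a a' h1 h2 h3 h4 => hs.out_unique a a' h1 h2 (hx' a h3).2 (hx' a' h4).2,
    fun a h1 h2 => hs.closed a (hx' a h1).2 h2, ?_, ?_⟩
  · split_ifs <;> simp [hs.x_nonneg]
  · split_ifs <;> simp [hs.supply_nonneg]
  · split_ifs <;> simp [hs.demand_nonneg, he.le]
  · intro a t t' ha haZ hpt hpt' hne hdt hdt'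
    obtain ⟨haY, ha'⟩ := hx' a ha
    rw [if_neg haY]
    by_cases ht : t = t₀
    · have hau : H.head a = H.tail e := by rw [← hpt, ht, Function.update_self]
      exact (hnew a t' ha' haZ hau (ht ▸ hne.symm) hpt' hdt').trans (le_max_right _ _)
    · by_cases ht' : t' = t₀
      · have hau : H.head a = H.tail e := by rw [← hpt', ht', Function.update_self]
        exact (hnew a t ha' haZ hau ht hpt hdt).trans (le_max_left _ _)
      · rw [Function.update_of_ne ht] at hpt
        rw [Function.update_of_ne ht'] at hpt'
        have e1 := hd' t ht hdt
        have e2 := hd' t' ht' hdt'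
        rw [e1] at hdt
        rw [e2] at hdt'
        simp only [e1, e2]
        exact hs.le_max a t t' ha' haZ hpt hpt' hne hdt hdt'
  · intro a o t ha haZ hpt ho hto hdt
    obtain ⟨haY, ha'⟩ := hx' a ha
    rw [if_neg haY]
    by_cases ht : t = t₀
    · have hau : H.head a = H.tail e := by rw [← hpt, ht, Function.update_self]
      have hoe : o = e := hs.out_unique o e (hto ▸ haZ) (hto.trans hau) (hx' o ho).2 he
      subst hoe
      exact absurd heY (hx' o ho).1
    · rw [Function.update_of_ne ht] at hpt
      have e1 := hd' t ht hdt
      rw [e1] at hdt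
      simp only [e1]
      exact hs.le_demand a o t ha' haZ hpt (hx' o ho).2 hto hdt

/-- The declared set may be enlarged to all vertices that do not reach a branching vertex, if no
terminal can be moved back along an arc that is not declared. -/
theorem IsState.enlarge (hs : IsState H κ x σ pos d Z)
    (hmove : ∀ e t, H.head e ∉ Z → pos t = H.head e → 0 < d t → x e < d t) :
    IsState H κ x σ pos d {z | ∀ y, Relation.ReflTransGen (H.Step x) z y → ¬ H.IsBranch x y} := by
  refine ⟨hs.x_nonneg, hs.supply_nonneg, hs.demand_nonneg, hs.balance, hs.mono, ?_, ?_, ?_, ?_⟩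
  · intro a a' ha haa hpa hpa'
    exact eq_of_not_isBranch (ha _ .refl) hpa hpa' rfl haa.symm
  · intro a hpa ha y hy
    exact ha y (hy.head ⟨a, hpa, rfl, rfl⟩)
  · intro a t t' hpa _ ht ht' hne hdt hdt'
    by_cases hZ : H.head a ∈ Z
    · exact hs.le_max a t t' hpa hZ ht ht' hne hdt hdt'
    · exact (hmove a t hZ ht hdt).le.trans (le_max_left _ _)
  · intro a o t hpa _ ht ho hto hdt
    by_cases hZ : H.head a ∈ Z
    · exact hs.le_demand a o t hpa hZ ht ho hto hdt
    · exact (hmove a t hZ ht hdt).le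

theorem IsState.subset (hs : IsState H κ x σ pos d Z) :
    Z ⊆ {z | ∀ y, Relation.ReflTransGen (H.Step x) z y → ¬ H.IsBranch x y} := by
  intro z hz y hy
  have hyZ : y ∈ Z := by
    induction hy with
    | refl => exact hz
    | tail _ h ih =>
      obtain ⟨a, ha, rfl, rfl⟩ := h
      exact hs.closed a ha ih
  rintro ⟨a, a', hne, ha, ha', rfl, h⟩
  exact hne (hs.out_unique a a' hyZ h.symm ha ha')

/-- Some terminal at a vertex without outgoing flow has at least the demand that a given arc
brings. -/
theorem IsState.exists_terminal (hs : IsState H κ x σ pos d Z) {e : E} (he : 0 < x e)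
    (heZ : H.head e ∈ Z) (hend : H.IsEnd x (H.head e)) : ∃ t, pos t = H.head e ∧ x e ≤ d t := by
  by_contra! hlt
  have hout : (∑ a, if H.tail a = H.head e then x a else 0) = 0 := by
    refine sum_eq_zero fun a _ => ?_
    split_ifs with h
    · by_contra h0
      exact hend a (lt_of_le_of_ne (hs.x_nonneg a) (Ne.symm h0)) h
    · rfl
  have hin : x e ≤ ∑ a, if H.head a = H.head e then x a else 0 := by
    refine le_trans (by simp) (single_le_sum (f := fun a => if H.head a = H.head e then x a else 0)
      (fun a _ => ?_) (mem_univ e))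
    split_ifs <;> simp [hs.x_nonneg]
  have hbal := hs.balance (H.head e)
  have hσ := hs.supply_nonneg (H.head e)
  unfold net at hbal
  have hsum : x e ≤ ∑ t, if pos t = H.head e then d t else 0 := by linarith
  obtain ⟨t, -, ht⟩ := exists_ne_zero_of_sum_ne_zero (he.trans_le hsum).ne'
  have hpt : pos t = H.head e := by by_contra h; simp [h] at ht
  rw [if_pos hpt] at ht
  have hdt : 0 < d t := lt_of_le_of_ne (hs.demand_nonneg t) (Ne.symm ht)
  rw [sum_eq_single t, if_pos hpt] at hsum
  · exact absurd hsum (not_le.2 (hlt t hpt))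
  · intro t' _ hne
    split_ifs with hpt'
    · by_contra h0
      have hdt' : 0 < d t' := lt_of_le_of_ne (hs.demand_nonneg t') (Ne.symm h0)
      have := hs.le_max e t t' he heZ hpt hpt' hne.symm hdt hdt'
      exact absurd this (not_le.2 (max_lt (hlt t hpt) (hlt t' hpt')))
    · rfl
  · simp

/-- Augmenting along a circulation that is positive only on arcs into `Z`, until an arc vanishes or
carries exactly the demand of a terminal at its head. -/
theorem IsState.exists_augment (hs : IsState H κ x σ pos d Z)
    (hne : ∀ e t, 0 < x e → H.head e ∈ Z → pos t = H.head e → x e ≠ d t) (δ : E → ℝ)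
    (hδ : ∀ v, H.net δ v = 0) (hsupp : ∀ a, δ a ≠ 0 → 0 < x a)
    (hpos : ∀ a, 0 < δ a → H.head a ∈ Z) (hneg : ∃ a, δ a < 0) :
    ∃ x', IsState H κ x' σ pos d Z ∧ (∀ a, 0 < x' a → 0 < x a) ∧
      (∀ a, H.head a ∉ Z → x' a ≤ x a) ∧
      ((∃ a, 0 < x a ∧ x' a = 0) ∨
        ∃ a t, 0 < x' a ∧ H.head a ∈ Z ∧ pos t = H.head a ∧ x' a = d t) := by
  -- The possible events are that a decreasing arc vanishes (`none`) and that an increasing arc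
  -- reaches the demand of a terminal `t` at its head (`some t`). By `hne` a demand that bounds an
  -- arc does so strictly at the start, so stopping at the first event preserves `le_max` and
  -- `le_demand`.
  let C : Finset (E × Option T) := univ.filter fun q => match q.2 with
    | none => δ q.1 < 0
    | some t => 0 < δ q.1 ∧ pos t = H.head q.1 ∧ x q.1 < d t
  let val : E × Option T → ℝ := fun q => match q.2 with
    | none => x q.1 / (-δ q.1)
    | some t => (d t - x q.1) / δ q.1
  obtain ⟨⟨a₀, o₀⟩, hq, hmin⟩ := C.exists_min_image val (by
    obtain ⟨a, ha⟩ := hneg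
    exact ⟨(a, none), by simpa [C] using ha⟩)
  obtain ⟨ε, hε⟩ : ∃ ε, ε = val (a₀, o₀) := ⟨_, rfl⟩
  rw [← hε] at hmin
  have hε0 : 0 < ε := by
    rw [hε]
    cases o₀ with
    | none =>
      have h1 : δ a₀ < 0 := by simpa [C] using hq
      exact div_pos (hsupp a₀ h1.ne) (neg_pos.2 h1)
    | some t =>
      have h1 : 0 < δ a₀ ∧ pos t = H.head a₀ ∧ x a₀ < d t := by simpa [C] using hq
      exact div_pos (sub_pos.2 h1.2.2) h1.1
  have hn : ∀ a, δ a < 0 → 0 ≤ x a + ε * δ a := by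
    intro a ha
    have h1 : ε ≤ x a / (-δ a) := hmin (a, none) (by simpa [C] using ha)
    rw [le_div_iff₀ (neg_pos.2 ha)] at h1
    linarith
  have hp : ∀ a t, 0 < δ a → pos t = H.head a → x a < d t → x a + ε * δ a ≤ d t := by
    intro a t ha ht hlt
    have h1 : ε ≤ (d t - x a) / δ a := hmin (a, some t) (by simpa [C] using ⟨ha, ht, hlt⟩)
    rw [le_div_iff₀ ha] at h1
    linarith
  have hsub : ∀ a, 0 < x a + ε * δ a → 0 < x a := by
    intro a ha
    by_cases h0 : δ a = 0
    · simpa [h0] using ha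
    · exact hsupp a h0
  have hdec : ∀ a, ¬ 0 < δ a → x a + ε * δ a ≤ x a := by
    intro a ha
    have := mul_nonneg hε0.le (neg_nonneg.2 (not_lt.1 ha))
    linarith
  refine ⟨fun a => x a + ε * δ a, ⟨fun a => ?_, hs.supply_nonneg, hs.demand_nonneg, fun v => ?_,
    hs.mono, fun a a' h1 h2 h3 h4 => hs.out_unique a a' h1 h2 (hsub a h3) (hsub a' h4),
    fun a h1 h2 => hs.closed a (hsub a h1) h2, ?_, ?_⟩, hsub,
    fun a ha => hdec a fun h => ha (hpos a h), ?_⟩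
  · by_cases h : δ a < 0
    · exact hn a h
    · have := mul_nonneg hε0.le (not_lt.1 h)
      have := hs.x_nonneg a
      linarith
  · rw [net_add, net_smul, hδ, mul_zero, add_zero, hs.balance v]
  · intro a t t' ha haZ ht ht' htt hdt hdt'
    have h1 := hs.le_max a t t' (hsub a ha) haZ ht ht' htt hdt hdt'
    by_cases h : 0 < δ a
    · rcases le_max_iff.1 h1 with h2 | h2
      · exact (hp a t h ht (lt_of_le_of_ne h2 (hne a t (hsub a ha) haZ ht))).trans (le_max_left _ _)
      · exact (hp a t' h ht' (lt_of_le_of_ne h2 (hne a t' (hsub a ha) haZ ht'))).trans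
          (le_max_right _ _)
    · exact (hdec a h).trans h1
  · intro a o t ha haZ ht ho hto hdt
    have h1 := hs.le_demand a o t (hsub a ha) haZ ht (hsub o ho) hto hdt
    by_cases h : 0 < δ a
    · exact hp a t h ht (lt_of_le_of_ne h1 (hne a t (hsub a ha) haZ ht))
    · exact (hdec a h).trans h1
  · cases o₀ with
    | none =>
      have h1 : δ a₀ < 0 := by simpa [C] using hq
      refine Or.inl ⟨a₀, hsupp a₀ h1.ne, ?_⟩
      have : ε * (-δ a₀) = x a₀ := by
        rw [hε]; exact div_mul_cancel₀ _ (neg_pos.2 h1).ne'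
      linarith
    | some t =>
      have h1 : 0 < δ a₀ ∧ pos t = H.head a₀ ∧ x a₀ < d t := by simpa [C] using hq
      have : ε * δ a₀ = d t - x a₀ := by
        rw [hε]; exact div_mul_cancel₀ _ h1.1.ne'
      have h2 : x a₀ + ε * δ a₀ = d t := by linarith
      refine Or.inr ⟨a₀, t, ?_, hpos a₀ h1.1, h1.2.1, h2⟩
      exact ((hs.x_nonneg a₀).trans_lt h1.2.2).trans_eq h2.symm

end

variable [Fintype W] [Fintype E] [Fintype T] [Fintype J] {H : ArcDigraph W E} {κ : E → J}

theorem IsState.routable_of_support_eq_empty [Nonempty J] {x : E → ℝ} {σ : W → ℝ} {pos : T → W}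
    {d : T → ℝ} {Z : Set W} (hs : IsState H κ x σ pos d Z) (hx : ∀ a, ¬ 0 < x a) :
    Routable H κ x σ pos d Z := by
  have hx0 : x = fun _ => 0 := funext fun a => le_antisymm (not_lt.1 (hx a)) (hs.x_nonneg a)
  obtain ⟨j₀⟩ := ‹Nonempty J›
  refine ⟨fun s t => if pos t = s then d t else 0, fun _ _ => [], fun _ => j₀,
    fun t j => if j = j₀ then d t else 0, fun s t => ?_, fun s t h => ?_, fun s => ?_, fun t => ?_,
    fun t j => ?_, fun t => ?_, fun a t => ?_, fun a S μ hμ _ => ?_, fun a t t' h => ?_⟩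
  · split_ifs <;> simp [hs.demand_nonneg]
  · by_cases h' : pos t = s
    · exact ⟨h'.symm, by simp⟩
    · simp [h'] at h
  · have := hs.balance s
    rw [hx0, net_zero] at this
    linarith
  · simp
  · split_ifs <;> simp [hs.demand_nonneg]
  · simp
  · simp only [arcLoad, List.not_mem_nil, if_false, sum_const_zero]
    split_ifs <;> simp [hs.demand_nonneg]
  · simp only [arcLoad, List.not_mem_nil, if_false, sum_const_zero]
    have := hs.x_nonneg a
    split_ifs <;> linarith
  · simp [arcLoad] at h

/-- Every state on an acyclic digraph is routable. -/
theorem IsState.routable [Nonempty J] (r : W → ℕ) (hr : ∀ a, r (H.tail a) < r (H.head a))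
    (hκ : ∀ a a', H.head a = H.tail a' → κ a = κ a') {x : E → ℝ} {σ : W → ℝ} {pos : T → W}
    {d : T → ℝ} {Z : Set W} (hs : IsState H κ x σ pos d Z) : Routable H κ x σ pos d Z := by
  obtain ⟨N, hN⟩ : ∃ N, #{a | 0 < x a} = N := ⟨_, rfl⟩
  induction N using Nat.strong_induction_on generalizing x σ pos d Z with
  | _ N ih =>
  have hcard : ∀ {x x' : E → ℝ}, #{a | 0 < x a} ≤ N → (∀ a, 0 < x' a → 0 < x a) →
      (∃ a, 0 < x a ∧ ¬ 0 < x' a) → #{a | 0 < x' a} < N := by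
    intro x x' hxN hsub ⟨a, ha, ha'⟩
    refine lt_of_lt_of_le (card_lt_card ⟨fun b hb => ?_, fun h => ?_⟩) hxN
    · simp only [mem_filter, mem_univ, true_and] at hb ⊢
      exact hsub b hb
    · have := h (show a ∈ _ by simpa using ha)
      simp only [mem_filter, mem_univ, true_and] at this
      exact ha' this
  -- An arc that carries exactly the demand of a terminal at its head disappears when the terminal
  -- is moved back along it.
  have hexact : ∀ {x : E → ℝ} {σ : W → ℝ} {pos : T → W} {d : T → ℝ} {Z : Set W},
      IsState H κ x σ pos d Z → #{a | 0 < x a} ≤ N →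
      (∃ e t, 0 < x e ∧ H.head e ∈ Z ∧ pos t = H.head e ∧ x e = d t) →
      Routable H κ x σ pos d Z := by
    intro x σ pos d Z hs hxN ⟨e, t, he, heZ, ht, hd⟩
    have h0 : 0 < d t := hd ▸ he
    refine Routable.of_move hκ ht.symm h0 hd.ge (fun _ => hd)
      (ih _ ?_ (hs.move hκ ht.symm h0 hd.ge fun _ => hd) rfl)
    refine hcard hxN (fun a ha => ?_) ⟨e, he, by simp [hd]⟩
    by_cases hae : a = e
    · exact hae ▸ he
    · simpa [hae] using ha
  -- A move along an arc not into `Z` may leave the support unchanged. The sum of the ranks of the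
  -- terminal positions then decreases, which justifies a second induction.
  obtain ⟨M, hM⟩ : ∃ M, ∑ t, r (pos t) = M := ⟨_, rfl⟩
  induction M using Nat.strong_induction_on generalizing x σ pos d Z with
  | _ M ihM =>
  by_cases hempty : ∃ a, 0 < x a
  swap
  · exact hs.routable_of_support_eq_empty (not_exists.1 hempty)
  by_cases hmove : ∃ e t, H.head e ∉ Z ∧ pos t = H.head e ∧ 0 < d t ∧ d t ≤ x e
  · obtain ⟨e, t, heZ, ht, hd, hle⟩ := hmove
    have hs' := hs.move hκ ht.symm hd hle fun h => absurd h heZ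
    refine Routable.of_move hκ ht.symm hd hle (fun h => absurd h heZ) ?_
    have hsub : ∀ a, 0 < Function.update x e (x e - d t) a → 0 < x a := by
      intro a ha
      by_cases hae : a = e
      · exact hae ▸ hd.trans_le hle
      · simpa [hae] using ha
    have hle' : #{a | 0 < Function.update x e (x e - d t) a} ≤ N := by
      rw [← hN]
      refine card_le_card fun a ha => ?_
      simp only [mem_filter, mem_univ, true_and] at ha ⊢
      exact hsub a ha
    rcases hle'.lt_or_eq with h | h
    · exact ih _ h hs' rfl
    · refine ihM _ ?_ hs' h rfl
      rw [← hM]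
      refine sum_lt_sum (fun t' _ => ?_) ⟨t, mem_univ t, ?_⟩
      · by_cases htt : t' = t
        · subst htt
          rw [Function.update_self, ht]; exact (hr e).le
        · rw [Function.update_of_ne htt]
      · rw [Function.update_self, ht]; exact hr e
  -- Now each arc not into `Z` carries less than any positive demand at its head. So the bounds
  -- required of arcs into the enlarged set hold automatically on the new arcs.
  push Not at hmove
  have hsZ := hs.enlarge hmove
  have hsubZ := hs.subset
  obtain ⟨Z', hZ'⟩ : ∃ Z', Z' =
    {z | ∀ y, Relation.ReflTransGen (H.Step x) z y → ¬ H.IsBranch x y} := ⟨_, rfl⟩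
  rw [← hZ'] at hsZ hsubZ
  suffices h : Routable H κ x σ pos d Z' by
    refine h.mono (fun _ => id) fun a => ?_
    by_cases h1 : H.head a ∈ Z
    · rw [if_pos h1, if_pos (hsubZ h1)]
    · rw [if_neg h1]
      split_ifs
      · exact hs.x_nonneg a
      · exact le_rfl
  have hendZ : ∀ v, H.IsEnd x v → v ∈ Z' := by
    intro v hv
    rw [hZ']
    intro y hy
    rcases hy.cases_head with rfl | ⟨c, ⟨a, ha, hav, -⟩, -⟩
    · rintro ⟨a, -, -, ha, -, hav, -⟩
      exact hv a ha hav
    · exact absurd hav (hv a ha)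
  have hmaxZ : ∀ a, 0 < x a → H.head a ∈ Z' → ¬ H.IsBranch x (H.tail a) → H.tail a ∈ Z' := by
    intro a ha haZ hb
    rw [hZ'] at haZ ⊢
    intro y hy
    rcases hy.cases_head with rfl | ⟨c, ⟨o, ho, hoa, hoc⟩, hcy⟩
    · exact hb
    · have : o = a := eq_of_not_isBranch hb ho ha hoa rfl
      subst this
      exact haZ y (hoc ▸ hcy)
  by_cases hex : ∃ e t, 0 < x e ∧ H.head e ∈ Z' ∧ pos t = H.head e ∧ x e = d t
  · exact hexact hsZ hN.le hex
  -- Case of an end of the flow where at most the entering arc `e` has a live tail.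
  by_cases hdead : ∃ e, 0 < x e ∧ H.IsEnd x (H.head e) ∧
      ∀ e', 0 < x e' → H.head e' = H.head e → e' ≠ e → ¬ H.IsLive x (H.tail e')
  · obtain ⟨e, he, hend, hdead⟩ := hdead
    obtain ⟨t, ht, hle⟩ := hsZ.exists_terminal he (hendZ _ hend) hend
    -- `Y` consists of the end and of all vertices that reach it through an arc other than `e`. A
    -- branching vertex in `Y` would make that arc live, so `Y` carries an in-tree, and `e` is the
    -- only arc with flow that enters it.
    obtain ⟨Y, hY⟩ : ∃ Y : Set W, Y = {v | v = H.head e ∨ ∃ e', 0 < x e' ∧ H.head e' = H.head e ∧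
      e' ≠ e ∧ Relation.ReflTransGen (H.Step x) v (H.tail e')} := ⟨_, rfl⟩
    have hnb : ∀ v ∈ Y, ¬ H.IsBranch x v := by
      intro v hv
      rw [hY] at hv
      rcases hv with rfl | ⟨e', he', hee, hne, hreach⟩
      · exact fun ⟨a, _, _, ha, _, hat, _⟩ => hend a ha hat
      · exact fun hb => hdead e' he' hee hne ⟨v, hb, hreach⟩
    have hout : ∀ a, 0 < x a → H.tail a ∈ Y → H.head a ∈ Y ∧ a ≠ e := by
      intro a ha haY
      have hb := hnb _ haY
      rw [hY] at haY
      rcases haY with h | ⟨e', he', hee, hne, hreach⟩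
      · exact absurd h (hend a ha)
      · rcases hreach.cases_head with h | ⟨c, ⟨o, ho, hot, hoc⟩, hcy⟩
        · have : a = e' := eq_of_not_isBranch hb ha he' rfl h.symm
          subst this
          exact ⟨by rw [hY]; exact Or.inl hee, hne⟩
        · have : o = a := eq_of_not_isBranch hb ho ha hot rfl
          subst this
          refine ⟨by rw [hY]; exact Or.inr ⟨e', he', hee, hne, hoc ▸ hcy⟩, ?_⟩
          rintro rfl
          rcases hcy.cases_head with h | ⟨c', ⟨o', ho', hot', -⟩, -⟩
          · exact hend e' he' (h.symm.trans hoc.symm)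
          · exact hend o' ho' (hot'.trans hoc.symm)
    have heY : H.head e ∈ Y := by rw [hY]; exact Or.inl rfl
    have hte : H.tail e ∉ Y := fun h => (hout e he h).2 rfl
    have hYin : ∀ a, 0 < x a → H.head a ∈ Y → a ≠ e → H.tail a ∈ Y := by
      intro a ha haY hae
      rw [hY] at haY ⊢
      rcases haY with h | ⟨e', he', hee, hne, hreach⟩
      · exact Or.inr ⟨a, ha, h, hae, .refl⟩
      · exact Or.inr ⟨e', he', hee, hne, hreach.head ⟨a, ha, rfl, rfl⟩⟩
    have hYout : ∀ a, 0 < x a → H.tail a ∈ Y → H.head a ∈ Y := fun a ha h => (hout a ha h).1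
    have hYZ : Y ⊆ Z' := by
      intro v hv
      rw [hZ']
      intro y hy
      refine hnb y ?_
      induction hy with
      | refl => exact hv
      | tail _ h ih =>
        obtain ⟨a, ha, rfl, rfl⟩ := h
        exact hYout a ha ih
    refine Routable.of_dead_tree r hr hκ hsZ he heY hte ht hle hYin hYout hYZ
      (fun a ha => hend a ha) (fun v hv hne => ?_)
      (ih _ ?_ (hsZ.outside hκ he heY hte ht hYin hYout) rfl)
    · rw [hY] at hv
      rcases hv with h | ⟨e', he', -, -, hreach⟩
      · exact absurd h hne
      · rcases hreach.cases_head with h | ⟨c, ⟨o, ho, hot, -⟩, -⟩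
        · exact ⟨e', he', h.symm⟩
        · exact ⟨o, ho, hot⟩
    · refine hcard hN.le (fun a ha => ?_) ⟨e, he, by simp [heY]⟩
      by_cases haY : H.head a ∈ Y
      · simp [haY] at ha
      · simpa [haY] using ha
  push Not at hdead hex
  -- Every end with inflow is now entered by two arcs with live tails: `hdead` for `a` yields one
  -- such arc `e`, and `hdead` for `e` a different one.
  obtain ⟨δ, hδ, hδs, hδp, hδ0⟩ := exists_alternating_circulation H r hr x Z' hsZ.out_unique hendZ
    hmaxZ (fun a ha hend => by
      obtain ⟨e, he, hea, -, hl⟩ := hdead a ha hend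
      obtain ⟨e', he', hee, hne, hl'⟩ := hdead e he (hea ▸ hend)
      exact ⟨e, e', hne.symm, he, he', hea, hee.trans hea, hl, hl'⟩) hempty
  obtain ⟨x', hs', hsub, hle, hcase⟩ := hsZ.exists_augment hex δ hδ hδs hδp
    (exists_neg_of_net_eq_zero H r hr δ hδ hδ0)
  have hrout : Routable H κ x' σ pos d Z' := by
    rcases hcase with ⟨a, ha, ha'⟩ | ⟨a, t, h⟩
    · exact ih _ (hcard hN.le hsub ⟨a, ha, by simp [ha']⟩) hs' rfl
    · refine hexact hs' ?_ ⟨a, t, h⟩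
      rw [← hN]
      refine card_le_card fun a ha => ?_
      simp only [mem_filter, mem_univ, true_and] at ha ⊢
      exact hsub a ha
  refine hrout.mono hsub fun a => ?_
  by_cases h : H.head a ∈ Z'
  · simp [h]
  · simpa [h] using hle a h

end ArcDigraph

end

/-! ### The layered digraph -/

noncomputable section

namespace ArcDigraph

open scoped Classical

/-- Copies of the support of `x` on `V × J`, with a common entrance and a common exit for all
copies of a vertex. -/
def layered {V A : Type*} (D : ArcDigraph V A) (x : A → ℝ) (J : Type*) :
    ArcDigraph (V ⊕ (V × J) ⊕ V) ((V × J) ⊕ ({a // 0 < x a} × J) ⊕ (V × J)) where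
  tail
    | .inl q => .inl q.1
    | .inr (.inl q) => .inr (.inl (D.tail q.1, q.2))
    | .inr (.inr q) => .inr (.inl q)
  head
    | .inl q => .inr (.inl q)
    | .inr (.inl q) => .inr (.inl (D.head q.1, q.2))
    | .inr (.inr q) => .inr (.inr q.1)

/-- The copy that an arc of the layered digraph belongs to. -/
def layerColor {V A : Type*} (x : A → ℝ) (J : Type*) :
    (V × J) ⊕ ({a // 0 < x a} × J) ⊕ (V × J) → J
  | .inl q => q.2
  | .inr (.inl q) => q.2
  | .inr (.inr q) => q.2

/-- The flow `x` divided evenly among the copies, where `k` is the number of copies. -/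
def layerFlow {V A : Type*} (b : V → ℝ) (x : A → ℝ) (k : ℝ) (J : Type*) :
    (V × J) ⊕ ({a // 0 < x a} × J) ⊕ (V × J) → ℝ
  | .inl q => max (b q.1) 0 / k
  | .inr (.inl q) => x q.1 / k
  | .inr (.inr q) => max (-b q.1) 0 / k

variable {V A J : Type*} {D : ArcDigraph V A} {x : A → ℝ}

theorem IsWalk.project_copy {v t : V} {j : J}
    {l : List ((V × J) ⊕ ({a // 0 < x a} × J) ⊕ (V × J))}
    (h : (D.layered x J).IsWalk (.inr (.inl (v, j))) (.inr (.inr t)) l) :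
    ∃ l', D.IsWalk v t l' ∧ ∀ a ∈ l', ∃ h : 0 < x a, .inr (.inl (⟨a, h⟩, j)) ∈ l := by
  induction l generalizing v with
  | nil => simp [IsWalk] at h
  | cons e l ih =>
    obtain ⟨he, hw⟩ := h
    rcases e with q | ⟨⟨a, ha⟩, j'⟩ | ⟨v', j'⟩
    · simp [layered] at he
    · simp only [layered, Sum.inr.injEq, Sum.inl.injEq, Prod.mk.injEq] at he
      obtain ⟨h1, rfl⟩ := he
      obtain ⟨l', hl', hmem⟩ := ih hw
      refine ⟨a :: l', ⟨h1, hl'⟩, fun b hb => ?_⟩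
      rcases List.mem_cons.1 hb with rfl | hb
      · exact ⟨ha, by simp⟩
      · obtain ⟨h2, h3⟩ := hmem b hb
        exact ⟨h2, by simp [h3]⟩
    · simp only [layered, Sum.inr.injEq, Sum.inl.injEq, Prod.mk.injEq] at he
      obtain ⟨rfl, rfl⟩ := he
      cases l with
      | nil =>
        have : v' = t := by simpa [layered, IsWalk] using hw
        exact ⟨[], this, by simp⟩
      | cons e' l =>
        have h1 := hw.1
        rcases e' with q | q | q <;> simp [layered] at h1

theorem IsWalk.project {s t : V}
    {l : List ((V × J) ⊕ ({a // 0 < x a} × J) ⊕ (V × J))}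
    (h : (D.layered x J).IsWalk (.inl s) (.inr (.inr t)) l) :
    ∃ l', D.IsWalk s t l' ∧ ∀ a ∈ l', ∃ (h : 0 < x a) (j : J), .inr (.inl (⟨a, h⟩, j)) ∈ l := by
  cases l with
  | nil => simp [IsWalk] at h
  | cons e l =>
    obtain ⟨he, hw⟩ := h
    rcases e with ⟨v, j⟩ | q | q
    · obtain rfl : v = s := by simpa [layered] using he
      obtain ⟨l', hl', hmem⟩ := hw.project_copy
      refine ⟨l', hl', fun a ha => ?_⟩
      obtain ⟨h1, h2⟩ := hmem a ha
      exact ⟨h1, j, by simp [h2]⟩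
    · simp [layered] at he
    · simp [layered] at he

variable [Fintype V] [Fintype A] [Fintype J]

/-- With `Z` empty all bounds on arcs into `Z` are void, and `mono` holds since each exit has just
one terminal. At a copy of `v` the balance is that of `x` divided by the number of copies, with `b
v` split into its positive and negative parts. -/
theorem isState_layered [Nonempty J] {b : V → ℝ} (hx : D.IsTransshipment b x) :
    IsState (D.layered x J) (layerColor x J) (layerFlow b x (Fintype.card J) J)
      (Sum.elim (fun v => max (b v) 0) fun _ => 0) (fun t => .inr (.inr t))
      (fun t => max (-b t) 0) ∅ := by
  have hk : (0:ℝ) < Fintype.card J := by exact_mod_cast Fintype.card_pos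
  rw [isTransshipment_iff_net] at hx
  refine ⟨?_, ?_, fun t => le_max_right _ _, ?_, ?_, by simp, by simp, by simp, by simp⟩
  · rintro (q | q | q)
    · exact div_nonneg (le_max_right _ _) hk.le
    · exact div_nonneg (hx.1 _) hk.le
    · exact div_nonneg (le_max_right _ _) hk.le
  · rintro (v | v)
    · exact le_max_right _ _
    · exact le_rfl
  · rintro (v | ⟨v, j⟩ | v)
    · simp only [net, Fintype.sum_sum_type, Fintype.sum_prod_type, layered, layerFlow]
      simp
      field_simp
    · have hsub : ∀ q : A → V, (∑ a : {a // 0 < x a}, if q a = v then x a / Fintype.card J else 0)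
          = (∑ a, if q a = v then x a else 0) / Fintype.card J := by
        intro q
        rw [sum_div, ← sum_filter_of_ne (p := fun a => 0 < x a), sum_subtype _ (p := fun a => 0 < x a)]
        · exact sum_congr rfl fun a _ => by split_ifs <;> simp
        · simp
        · intro a _ h0
          refine lt_of_le_of_ne (hx.1 a) fun h => h0 ?_
          simp [← h]
      have hv := hx.2 v
      have hmax : max (b v) 0 - max (-b v) 0 = b v := by
        rcases le_total (b v) 0 with h | h
        · rw [max_eq_right h, max_eq_left (by linarith)]; ring
        · rw [max_eq_left h, max_eq_right (by linarith)]; ring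
      have e1 : ∀ q : A → V, (∑ a : {a // 0 < x a}, ∑ j' : J,
          if q a = v ∧ j' = j then x a / (Fintype.card J : ℝ) else 0)
          = (∑ a, if q a = v then x a else 0) / Fintype.card J := by
        intro q
        rw [← hsub]
        refine sum_congr rfl fun a _ => ?_
        by_cases h : q a = v <;> simp [h]
      have e2 : ∀ z : V → ℝ, (∑ w, ∑ j' : J, if w = v ∧ j' = j then z w / (Fintype.card J : ℝ) else 0)
          = z v / Fintype.card J := by
        intro z
        rw [sum_eq_single v]
        · simp
        · intro w _ h; simp [h]
        · simp
      simp only [net, Fintype.sum_sum_type, Fintype.sum_prod_type, layered, layerFlow,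
        Sum.inr.injEq, Sum.inl.injEq, Prod.mk.injEq, reduceCtorEq, if_false, sum_const_zero,
        zero_add, add_zero, e1, e2, Sum.elim_inr, sub_zero]
      unfold net at hv
      rw [← add_div, ← add_div, ← sub_div, div_eq_zero_iff]
      left
      linarith
    · simp only [net, Fintype.sum_sum_type, Fintype.sum_prod_type, layered, layerFlow]
      simp
      field_simp
  · intro a a' t t' _ _ h _
    simpa using h.symm

/-- Routing the demands in copies of an acyclic transshipment, and projecting to the digraph. The
amount `L j a t` is the flow to `t` in the copy `j` of the arc `a`. -/
theorem exists_layered_routing [Nonempty J] {b : V → ℝ} (hx : D.IsTransshipment b x) {r : V → ℕ}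
    (hr : ∀ a, 0 < x a → r (D.tail a) < r (D.head a)) :
    ∃ (f : V → V → ℝ) (P : V → V → List A) (p : V → J) (g : V → J → ℝ) (L : J → A → V → ℝ),
      (∀ s t, 0 ≤ f s t) ∧
      (∀ s t, f s t ≠ 0 → 0 < b s ∧ b t < 0 ∧ D.IsPath s t (P s t)) ∧
      (∀ s, ∑ t, f s t = max (b s) 0) ∧ (∀ t, ∑ s, f s t = max (-b t) 0) ∧
      (∀ t j, 0 ≤ g t j) ∧ (∀ t, ∑ j, g t j = max (-b t) 0) ∧
      (∀ a t, arcLoad f P a t ≤ ∑ j, L j a t) ∧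
      (∀ j a t, L j a t ≤ g t j) ∧
      (∀ j a (S : Finset V) (μ : ℝ), 0 ≤ μ → (∀ t ∈ S, g t j ≤ μ) →
        ∑ t ∈ S, L j a t ≤ x a / Fintype.card J + μ) ∧
      (∀ j a t t', L j a t ≠ 0 → L j a t' ≠ 0 → p t ≠ j → p t' ≠ j → t = t') := by
  have hk : (0:ℝ) < Fintype.card J := by exact_mod_cast Fintype.card_pos
  have hx0 := hx.1
  obtain ⟨f, P, p, g, h⟩ := (isState_layered (J := J) hx).routable
    (Sum.elim (fun _ => 0) (Sum.elim (fun q => r q.1 + 1) fun _ => univ.sup r + 2))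
    (by
      rintro (q | ⟨⟨a, ha⟩, j⟩ | q)
      · simp [layered]
      · simpa [layered] using hr a ha
      · have := le_sup (f := r) (mem_univ q.1)
        simp only [layered, Sum.elim_inr, Sum.elim_inl]
        omega)
    (by
      rintro (q | q | q) (q' | q' | q') hh <;> simp [layered] at hh
      · simp [layerColor, hh]
      · simp [layerColor, hh]
      · simp [layerColor, hh]
      · simp [layerColor, ← hh])
  have hP : ∀ s t, ∃ l, f (.inl s) t ≠ 0 → D.IsWalk s t l ∧
      ∀ a ∈ l, ∃ (h : 0 < x a) (j : J), .inr (.inl (⟨a, h⟩, j)) ∈ P (.inl s) t := by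
    intro s t
    by_cases h0 : f (.inl s) t = 0
    · exact ⟨[], fun hn => absurd h0 hn⟩
    · obtain ⟨l, hl⟩ := (h.walk _ t h0).1.project
      exact ⟨l, fun _ => hl⟩
  choose Q hQ using hP
  have hcol : ∀ t, ∑ s, f (.inl s) t = max (-b t) 0 := by
    intro t
    rw [← h.sum_demand t, Fintype.sum_sum_type, left_eq_add]
    refine sum_eq_zero fun w _ => ?_
    have := h.sum_supply (.inr w)
    exact (sum_eq_zero_iff_of_nonneg fun t _ => h.nonneg _ t).1 this t (mem_univ t)
  refine ⟨fun s t => f (.inl s) t, Q, p, g, fun j a t => if ha : 0 < x a then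
    arcLoad f P (.inr (.inl (⟨a, ha⟩, j))) t else 0, fun s t => h.nonneg _ t, fun s t h0 => ?_,
    fun s => h.sum_supply (.inl s), hcol, h.color_nonneg, h.sum_color, fun a t => ?_,
    fun j a t => ?_, fun j a S μ hμ hS => ?_, fun j a t t' h0 h0' hp hp' => ?_⟩
  · have hpos : 0 < f (.inl s) t := lt_of_le_of_ne (h.nonneg _ t) (Ne.symm h0)
    obtain ⟨hw, hm⟩ := hQ s t h0
    refine ⟨?_, ?_, hw.isPath (r := r) fun a ha => hr a (hm a ha).1⟩
    · have h1 : f (.inl s) t ≤ max (b s) 0 := by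
        rw [← show _ = max (b s) 0 from h.sum_supply (.inl s)]
        exact single_le_sum (f := f (.inl s)) (fun t _ => h.nonneg _ t) (mem_univ t)
      by_contra hb
      rw [max_eq_right (not_lt.1 hb)] at h1
      linarith
    · have h1 : f (.inl s) t ≤ max (-b t) 0 := by
        rw [← hcol t]
        exact single_le_sum (f := fun s => f (.inl s) t) (fun s _ => h.nonneg _ t) (mem_univ s)
      by_contra hb
      rw [max_eq_right (by linarith)] at h1
      linarith
  · by_cases ha : 0 < x a
    · simp only [ha, dif_pos]
      -- A projected path that uses `a` comes from a walk that uses some copy of `a`, so the load on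
      -- `a` is at most the sum over its copies.
      have h1 : ∀ j, (∑ s, if .inr (.inl (⟨a, ha⟩, j)) ∈ P (.inl s) t then f (.inl s) t else 0)
          ≤ arcLoad f P (.inr (.inl (⟨a, ha⟩, j))) t := by
        intro j
        rw [arcLoad, Fintype.sum_sum_type]
        refine le_trans (le_of_eq (sum_congr rfl fun s _ => ?_)) (le_add_of_nonneg_right
          (sum_nonneg fun s _ => ?_))
        · congr
        · split_ifs <;> simp [h.nonneg]
      refine le_trans ?_ (sum_le_sum fun j _ => h1 j)
      rw [sum_comm]
      refine sum_le_sum fun s _ => ?_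
      have hnn : ∀ j ∈ (univ : Finset J), 0 ≤ if .inr (.inl (⟨a, ha⟩, j)) ∈ P (.inl s) t
          then f (.inl s) t else 0 := fun j _ => by split_ifs <;> simp [h.nonneg]
      by_cases h0 : f (.inl s) t = 0
      · simp [h0]
      by_cases hm : a ∈ Q s t
      · obtain ⟨_, j, hj⟩ := (hQ s t h0).2 a hm
        rw [if_pos hm]
        refine le_trans ?_ (single_le_sum hnn (mem_univ j))
        rw [if_pos hj]
      · rw [if_neg hm]
        exact sum_nonneg hnn
    · simp only [ha, dif_neg, not_false_eq_true, sum_const_zero]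
      refine le_of_eq (sum_eq_zero fun s _ => ?_)
      by_cases h0 : f (.inl s) t = 0
      · simp [h0]
      · rw [if_neg]
        exact fun hm => ha ((hQ s t h0).2 a hm).1
  · by_cases ha : 0 < x a
    · simp only [ha, dif_pos]
      exact h.load_le_color (.inr (.inl (⟨a, ha⟩, j))) t
    · simp only [ha, dif_neg, not_false_eq_true]
      exact h.color_nonneg t j
  · by_cases ha : 0 < x a
    · simp only [ha, dif_pos]
      have := h.load_le (.inr (.inl (⟨a, ha⟩, j))) S μ hμ fun t ht _ => hS t ht
      simpa [layerFlow] using this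
    · simp only [ha, dif_neg, not_false_eq_true, sum_const_zero]
      have := div_nonneg (hx0 a) hk.le
      linarith
  · by_cases ha : 0 < x a
    · simp only [ha, dif_pos] at h0 h0'
      exact h.unique _ t t' h0 h0' hp hp'
    · simp [ha] at h0

end ArcDigraph

end

/-! ### Rounding proportions and the load of one round -/

noncomputable section

open scoped Classical

/-- The vectors of `n + 1` natural numbers whose sum is between `M - n` and `M`, where
`M = (n² - 1)(n + 1)`. -/
def roundTypes (n : ℕ) : Finset (Fin (n + 1) →₀ ℕ) :=
  (range (n + 1)).biUnion fun j => finsuppAntidiag univ ((n ^ 2 - 1) * (n + 1) - j)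

theorem le_sq_sub_one_mul {n : ℕ} (hn : 2 ≤ n) : n ≤ (n ^ 2 - 1) * (n + 1) := by
  have h1 : 1 ≤ n ^ 2 - 1 := by
    have : 2 * 2 ≤ n ^ 2 := by rw [sq]; exact Nat.mul_le_mul hn hn
    omega
  nlinarith

/-- Stars and bars for each total `M - j`; since `n ≤ M` for `2 ≤ n`, no subtraction truncates. -/
theorem card_roundTypes_le {n : ℕ} (hn : 2 ≤ n) : #(roundTypes n) ≤ groupCount n := by
  refine card_biUnion_le.trans (sum_le_sum fun j hj => ?_)
  have h1 := le_sq_sub_one_mul hn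
  have h2 : j ≤ n := Nat.lt_succ_iff.1 (mem_range.1 hj)
  rw [card_finsuppAntidiag_nat_eq_choose, card_univ, Fintype.card_fin]
  obtain ⟨k, hk⟩ := Nat.exists_eq_add_of_le (h2.trans h1)
  rw [hk, Nat.add_sub_cancel_left, show n + 1 + k - 1 = n + k by omega,
    show j + k + n - j = n + k by omega, ← Nat.choose_symm_add]

/-- Rounding down multiples of `1 / M` that add up to one. -/
theorem floor_mem_roundTypes {n : ℕ} (hn : 2 ≤ n) {g : Fin (n + 1) → ℝ} {d : ℝ} (hd : 0 < d)
    (hg : ∀ j, 0 ≤ g j) (hsum : ∑ j, g j = d) :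
    Finsupp.equivFunOnFinite.symm
      (fun j => ⌊(((n ^ 2 - 1) * (n + 1) : ℕ) : ℝ) * g j / d⌋₊) ∈ roundTypes n := by
  obtain ⟨M, hM⟩ : ∃ M, M = (n ^ 2 - 1) * (n + 1) := ⟨_, rfl⟩
  have hnM : n ≤ M := hM ▸ le_sq_sub_one_mul hn
  rw [roundTypes, ← hM]
  obtain ⟨τ, hτ⟩ : ∃ τ : Fin (n + 1) → ℕ, τ = fun j => ⌊(M : ℝ) * g j / d⌋₊ := ⟨_, rfl⟩
  have hnn : ∀ j, 0 ≤ (M : ℝ) * g j / d := fun j =>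
    div_nonneg (mul_nonneg (Nat.cast_nonneg _) (hg j)) hd.le
  have htot : ∑ j, (M : ℝ) * g j / d = M := by
    rw [← sum_div, ← mul_sum, hsum, mul_div_cancel_right₀ _ hd.ne']
  have h1 : ((∑ j, τ j : ℕ) : ℝ) ≤ M := by
    rw [← htot, Nat.cast_sum]
    refine sum_le_sum fun j _ => ?_
    rw [hτ]
    exact Nat.floor_le (hnn j)
  -- Each of the `n + 1` floors loses less than one, so their integer sum is at least `M - n`.
  have h2 : (M : ℝ) < ((∑ j, τ j : ℕ) : ℝ) + (n + 1) := by
    have h3 : ∑ j, (M : ℝ) * g j / d < ∑ j, ((τ j : ℝ) + 1) := by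
      refine sum_lt_sum_of_nonempty univ_nonempty fun j _ => ?_
      rw [hτ]
      exact Nat.lt_floor_add_one _
    rw [htot, sum_add_distrib] at h3
    simpa using h3
  have h1' : ∑ j, τ j ≤ M := by exact_mod_cast h1
  have h2' : M < ∑ j, τ j + (n + 1) := by exact_mod_cast h2
  refine mem_biUnion.2 ⟨M - ∑ j, τ j, mem_range.2 (by omega), ?_⟩
  rw [mem_finsuppAntidiag]
  refine ⟨?_, subset_univ _⟩
  rw [Nat.sub_sub_self h1', hτ]
  rfl

namespace ArcDigraph

variable {V A : Type*} [Fintype V]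

/-- The load of a round: flow in the copy `p` is bounded by its share of `x` plus one demand, and in
any other copy by one demand. -/
theorem round_load_le {x c : A → ℝ} {n : ℕ} (hn : 2 ≤ n) {f : V → V → ℝ} {P : V → V → List A}
    {p : V → Fin (n + 1)} {g : V → Fin (n + 1) → ℝ} {L : Fin (n + 1) → A → V → ℝ} {dmax : ℝ}
    (hload : ∀ a t, arcLoad f P a t ≤ ∑ j, L j a t) (hLg : ∀ j a t, L j a t ≤ g t j)
    (hL : ∀ j a (S : Finset V) (μ : ℝ), 0 ≤ μ → (∀ t ∈ S, g t j ≤ μ) →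
        ∑ t ∈ S, L j a t ≤ x a / (n + 1) + μ)
    (huniq : ∀ j a t t', L j a t ≠ 0 → L j a t' ≠ 0 → p t ≠ j → p t' ≠ j → t = t')
    {a : A} (hxc : x a ≤ c a) (hd0 : 0 ≤ dmax) (hdc : dmax ≤ (1 - 1 / (n : ℝ)) * c a)
    {τ : Fin (n + 1) → ℕ} (hτ : ∑ j, τ j ≤ (n ^ 2 - 1) * (n + 1)) {q : Fin (n + 1)}
    {S : Finset V} (hSp : ∀ t ∈ S, p t = q)
    (hSg : ∀ t ∈ S, ∀ j, g t j ≤ (τ j + 1) / (((n ^ 2 - 1) * (n + 1) : ℕ) : ℝ) * dmax) :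
    ∑ t ∈ S, arcLoad f P a t ≤ c a := by
  obtain ⟨M, hM⟩ : ∃ M : ℝ, M = (((n ^ 2 - 1) * (n + 1) : ℕ) : ℝ) := ⟨_, rfl⟩
  rw [← hM] at hSg
  have hn' : (2 : ℝ) ≤ n := by exact_mod_cast hn
  have hMeq : M = ((n : ℝ) ^ 2 - 1) * (n + 1) := by
    rw [hM]
    have : 1 ≤ n ^ 2 := Nat.one_le_pow _ _ (by omega)
    push_cast [Nat.cast_sub this]
    ring
  have hn2 : 0 < (n : ℝ) ^ 2 - 1 := by nlinarith
  have hM0 : 0 < M := by rw [hMeq]; positivity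
  have hμ : ∀ j, 0 ≤ ((τ j : ℝ) + 1) / M * dmax := fun j => by positivity
  calc ∑ t ∈ S, arcLoad f P a t ≤ ∑ t ∈ S, ∑ j, L j a t := sum_le_sum fun t _ => hload a t
    _ = ∑ j, ∑ t ∈ S, L j a t := sum_comm
    _ ≤ ∑ j, ((if j = q then x a / (n + 1) else 0) + ((τ j : ℝ) + 1) / M * dmax) := by
        refine sum_le_sum fun j _ => ?_
        -- All sinks of the round prefer copy `q`. In any other copy the arc therefore serves at
        -- most one of them, and the share of `x` does not enter.
        by_cases hj : j = q
        · rw [if_pos hj]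
          exact hL j a S _ (hμ j) fun t ht => hSg t ht j
        · rw [if_neg hj, zero_add]
          have hpj : ∀ t ∈ S, p t ≠ j := fun t ht h => hj (h.symm.trans (hSp t ht))
          by_cases hex : ∃ t ∈ S, L j a t ≠ 0
          · obtain ⟨t, ht, h0⟩ := hex
            rw [sum_eq_single t]
            · exact (hLg j a t).trans (hSg t ht j)
            · intro t' ht' hne
              by_contra h0'
              exact hne (huniq j a t' t h0' h0 (hpj t' ht') (hpj t ht))
            · exact fun h => absurd ht h
          · push Not at hex
            rw [sum_eq_zero hex]
            exact hμ j
    _ = x a / (n + 1) + ((∑ j, τ j : ℕ) + (n + 1)) / M * dmax := by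
        rw [sum_add_distrib, ← sum_mul, ← sum_div, sum_add_distrib]
        simp
    _ ≤ c a / (n + 1) + (M + (n + 1)) / M * ((1 - 1 / (n : ℝ)) * c a) := by
        have h1 : ((∑ j, τ j : ℕ) : ℝ) ≤ M := by rw [hM]; exact_mod_cast hτ
        gcongr
    -- For `M = (n² - 1)(n + 1)` the factor `(M + n + 1) / M` is `n² / (n² - 1)`, and its product
    -- with `1 - 1 / n` is `n / (n + 1)`. This is what determines the choice of `M`.
    _ = c a := by
        rw [hMeq]
        have h3 : (n : ℝ) ≠ 0 := by positivity
        have h4 : (n : ℝ) + 1 ≠ 0 := by positivity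
        have h5 : (n : ℝ) ^ 2 - 1 ≠ 0 := hn2.ne'
        field_simp
        ring

variable [Fintype A] {D : ArcDigraph V A} {b : V → ℝ}

/-- A path routing of all demands and a partition of the sinks into rounds that respect the
capacities yield unsplittable transshipments. -/
theorem routableInRounds_of_routing {c : A → ℝ} {K : ℕ} {f : V → V → ℝ} {P : V → V → List A}
    (hf : ∀ s t, 0 ≤ f s t) (hP : ∀ s t, f s t ≠ 0 → 0 < b s ∧ b t < 0 ∧ D.IsPath s t (P s t))
    (hfs : ∀ s, ∑ t, f s t = max (b s) 0) (hft : ∀ t, ∑ s, f s t = max (-b t) 0)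
    (cls : V → Fin K)
    (hcap : ∀ i a, ∑ t with b t < 0 ∧ cls t = i, arcLoad f P a t ≤ c a) :
    D.RoutableInRounds b c K := by
  obtain ⟨F, hF⟩ : ∃ F : Fin K → V → V → ℝ,
    F = fun i s t => if b t < 0 ∧ cls t = i then f s t else 0 := ⟨_, rfl⟩
  have hF0 : ∀ i s t, 0 ≤ F i s t := fun i s t => by
    rw [hF]; dsimp only; split_ifs <;> simp [hf]
  have hFne : ∀ i s t, F i s t ≠ 0 → f s t ≠ 0 ∧ b t < 0 ∧ cls t = i := by
    intro i s t h
    rw [hF] at h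
    by_cases hc : b t < 0 ∧ cls t = i
    · simp only [hc, and_self, if_true] at h; exact ⟨h, hc⟩
    · simp [hc] at h
  have hfzero : ∀ s, b s ≤ 0 → ∀ t, f s t = 0 := by
    intro s hs t
    by_contra h
    exact absurd (hP s t h).1 (not_lt.2 hs)
  obtain ⟨β, hβ⟩ : ∃ β : Fin K → V → ℝ, β = fun i v =>
    if b v < 0 then (if cls v = i then b v else 0) else ∑ t, F i v t := ⟨_, rfl⟩
  have hβpos : ∀ i v, ¬ b v < 0 → β i v = ∑ t, F i v t := fun i v hv => by
    rw [hβ]; simp only [hv, if_false]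
  have hβneg : ∀ i v, b v < 0 → β i v = if cls v = i then b v else 0 := fun i v hv => by
    rw [hβ]; simp only [hv, if_true]
  refine ⟨fun i => {v | b v < 0 ∧ cls v = i}, β,
    fun i a => ∑ s, ∑ t, if a ∈ P s t then F i s t else 0, fun i v hv => hv.1, fun v hv => ?_,
    fun i v hv => ?_, fun i v hv hvT => ?_, fun i v hv => ?_, fun i v hv => ?_, fun v hv => ?_,
    fun i => ⟨?_, P, F i, hF0 i, fun s t h => ?_, fun a => ?_⟩, fun i a => ?_⟩
  · exact ⟨cls v, ⟨hv, rfl⟩, fun i hi => hi.2.symm⟩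
  · rw [hβneg i v hv.1, if_pos hv.2]
  · rw [hβneg i v hv, if_neg fun h => hvT ⟨hv, h⟩]
  · rw [hβpos i v hv.not_lt]
    refine sum_eq_zero fun t _ => ?_
    by_contra h
    exact (hFne i v t h).1 (hfzero v hv.le t)
  · rw [hβpos i v hv.le.not_gt]
    exact sum_nonneg fun t _ => hF0 i v t
  · simp only [hβpos _ v hv.le.not_gt]
    rw [sum_comm, ← max_eq_left hv.le, ← hfs v]
    refine sum_congr rfl fun t _ => ?_
    rw [hF]
    by_cases ht : b t < 0
    · simp [ht]
    · have : f v t = 0 := by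
        by_contra h
        exact ht (hP v t h).2.1
      simp [this]
  · rw [isTransshipment_iff_net]
    refine ⟨fun a => sum_nonneg fun s _ => sum_nonneg fun t _ => ?_, fun v => ?_⟩
    · split_ifs <;> simp [hF0]
    · have h1 : ∀ s t, D.net (fun a => if a ∈ P s t then F i s t else 0) v
          = (if s = v then F i s t else 0) - if t = v then F i s t else 0 := by
        intro s t
        by_cases h0 : F i s t = 0
        · simp [h0, net_zero]
        · obtain ⟨hw, hnd⟩ := (hP s t (hFne i s t h0).1).2.2
          have hnd' : (P s t).Nodup := (List.nodup_cons.1 hnd).2.of_map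
          have h2 : (fun a => if a ∈ P s t then F i s t else 0)
              = fun a => F i s t * ((P s t).count a : ℝ) := by
            funext a
            by_cases ha : a ∈ P s t
            · rw [if_pos ha, List.count_eq_one_of_mem hnd' ha]; simp
            · rw [if_neg ha, List.count_eq_zero_of_not_mem ha]; simp
          rw [h2, net_smul, hw.net_count]
          split_ifs <;> simp
      rw [net_sum]
      simp only [net_sum, h1, sum_sub_distrib]
      have h2 : (∑ s, ∑ t, if s = v then F i s t else 0) = ∑ t, F i v t := by
        rw [sum_comm]
        simp
      have h3 : (∑ s, ∑ t, if t = v then F i s t else 0) = ∑ s, F i s v := by simp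
      rw [h2, h3]
      by_cases hv : b v < 0
      · rw [hβneg i v hv]
        have h4 : ∑ t, F i v t = 0 := sum_eq_zero fun t _ => by
          by_contra h
          exact (hFne i v t h).1 (hfzero v hv.le t)
        have h5 : ∑ s, F i s v = if cls v = i then -b v else 0 := by
          rw [hF]
          by_cases hc : cls v = i
          · simp only [hv, hc, and_self, if_true]
            rw [hft v, max_eq_left (by linarith)]
          · simp [hc]
        rw [h4, h5]
        split_ifs <;> simp
      · rw [hβpos i v hv]
        have h5 : ∑ s, F i s v = 0 := sum_eq_zero fun s _ => by
          by_contra h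
          exact hv (hFne i s v h).2.1
        rw [h5, sub_zero]
  · obtain ⟨h1, h2, h3⟩ := hFne i s t h
    obtain ⟨h4, -, h5⟩ := hP s t h1
    refine ⟨?_, ?_, h5⟩
    · rw [hβpos i s h4.le.not_gt]
      have h6 : 0 < F i s t := lt_of_le_of_ne (hF0 i s t) (Ne.symm h)
      exact h6.trans_le (single_le_sum (f := F i s) (fun t _ => hF0 i s t) (mem_univ t))
    · rw [hβneg i t h2, if_pos h3]
      exact h2
  · refine sum_congr rfl fun s _ => sum_congr rfl fun t _ => ?_
    congr
  · refine le_trans (le_of_eq ?_) (hcap i a)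
    dsimp only
    rw [sum_comm, sum_filter]
    refine sum_congr rfl fun t _ => ?_
    rw [hF, arcLoad]
    by_cases hc : b t < 0 ∧ cls t = i
    · simp [hc]
    · simp [hc]

end ArcDigraph

end

/-! ### Assembling the rounds -/

noncomputable section

namespace ArcDigraph

open scoped Classical

variable {V A : Type*} [Fintype V] [Fintype A] {D : ArcDigraph V A} {b : V → ℝ}

/-- Rounds are indexed by pairs of a preferred copy and a vector of rounded proportions, embedded
into `Fin K`; indices outside the image serve no sink. Within a round `g t j` is less than `(τ j +
1) / M` times the demand of `t`, as `round_load_le` needs. -/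
theorem routableInRounds_of_exists_sink {c x : A → ℝ} (hx : D.IsTransshipment b x)
    (hxc : ∀ a, x a ≤ c a) {r : V → ℕ} (hr : ∀ a, 0 < x a → r (D.tail a) < r (D.head a)) {n : ℕ}
    (hn : 2 ≤ n) {dmax : ℝ} (hd0 : 0 ≤ dmax) (hbd : ∀ t, b t < 0 → -b t ≤ dmax)
    (hdc : ∀ a, dmax ≤ (1 - 1 / (n : ℝ)) * c a) :
    D.RoutableInRounds b c ((n + 1) * (groupCount n + 1)) := by
  obtain ⟨f, P, p, g, L, hf, hP, hfs, hft, hg, hgs, hload, hLg, hL, huniq⟩ :=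
    exists_layered_routing (J := Fin (n + 1)) hx hr
  obtain ⟨M, hM⟩ : ∃ M : ℝ, M = (((n ^ 2 - 1) * (n + 1) : ℕ) : ℝ) := ⟨_, rfl⟩
  have hM0 : 0 < M := by
    have := le_sq_sub_one_mul hn
    rw [hM]
    exact_mod_cast (show 0 < n by omega).trans_le this
  obtain ⟨τ, hτ⟩ : ∃ τ : V → Fin (n + 1) →₀ ℕ, τ = fun t => Finsupp.equivFunOnFinite.symm
      (fun j => ⌊M * g t j / (-b t)⌋₊) := ⟨_, rfl⟩
  have hτmem : ∀ t, b t < 0 → τ t ∈ roundTypes n := by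
    intro t ht
    rw [hτ, hM]
    refine floor_mem_roundTypes hn (neg_pos.2 ht) (hg t) ?_
    rw [hgs t, max_eq_left (neg_pos.2 ht).le]
  have hcard : Fintype.card (Fin (n + 1) × roundTypes n)
      ≤ Fintype.card (Fin ((n + 1) * (groupCount n + 1))) := by
    rw [Fintype.card_prod, Fintype.card_fin, Fintype.card_fin, Fintype.card_coe]
    exact Nat.mul_le_mul_left _ ((card_roundTypes_le hn).trans (Nat.le_succ _))
  obtain ⟨ι⟩ := Function.Embedding.nonempty_of_card_le hcard
  refine routableInRounds_of_routing hf hP hfs hft (fun t => if ht : b t < 0 then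
    ι (p t, ⟨τ t, hτmem t ht⟩) else ⟨0, Nat.mul_pos (Nat.succ_pos _) (Nat.succ_pos _)⟩)
    fun i a => ?_
  by_cases hex : ∃ t, b t < 0 ∧ (if ht : b t < 0 then
      ι (p t, ⟨τ t, hτmem t ht⟩) else ⟨0, Nat.mul_pos (Nat.succ_pos _) (Nat.succ_pos _)⟩) = i
  · obtain ⟨t₀, ht₀, hi⟩ := hex
    rw [dif_pos ht₀] at hi
    have hS : ∀ t ∈ univ.filter (fun t => b t < 0 ∧ (if ht : b t < 0 then
        ι (p t, ⟨τ t, hτmem t ht⟩) else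
          ⟨0, Nat.mul_pos (Nat.succ_pos _) (Nat.succ_pos _)⟩) = i),
        b t < 0 ∧ p t = p t₀ ∧ τ t = τ t₀ := by
      intro t ht
      obtain ⟨h1, h2⟩ := (mem_filter.1 ht).2
      rw [dif_pos h1, ← hi] at h2
      have h3 := ι.injective h2
      simp only [Prod.mk.injEq, Subtype.mk.injEq] at h3
      exact ⟨h1, h3⟩
    refine round_load_le hn hload hLg (fun j a S μ hμ h => ?_) huniq (hxc a) hd0 (hdc a)
      (τ := τ t₀) ?_ (fun t ht => (hS t ht).2.1) fun t ht j => ?_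
    · simpa using hL j a S μ hμ h
    · obtain ⟨k, -, hk⟩ := mem_biUnion.1 (hτmem t₀ ht₀)
      rw [mem_finsuppAntidiag] at hk
      exact hk.1.le.trans (Nat.sub_le _ _)
    · obtain ⟨h1, -, h3⟩ := hS t ht
      rw [← hM, ← h3]
      have hb : 0 < -b t := neg_pos.2 h1
      have h4 : M * g t j / (-b t) < (τ t j : ℝ) + 1 := by
        rw [hτ]
        exact Nat.lt_floor_add_one _
      rw [div_lt_iff₀ hb] at h4
      have h5 : ((τ t j : ℝ) + 1) * (-b t) ≤ ((τ t j : ℝ) + 1) * dmax :=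
        mul_le_mul_of_nonneg_left (hbd t h1) (by positivity)
      rw [div_mul_eq_mul_div, le_div_iff₀ hM0]
      linarith
  · push Not at hex
    rw [sum_eq_zero]
    · exact (hx.1 a).trans (hxc a)
    · intro t ht
      obtain ⟨h1, h2⟩ := (mem_filter.1 ht).2
      exact absurd h2 (hex t h1)

theorem routableInRounds_of_nonneg (hb : ∑ v, b v = 0) {c : A → ℝ} (hc : ∀ a, 0 ≤ c a)
    (hsink : ∀ v, 0 ≤ b v) {K : ℕ} (hK : 0 < K) : D.RoutableInRounds b c K := by
  have hb0 : ∀ v, b v = 0 := fun v =>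
    (sum_eq_zero_iff_of_nonneg fun v _ => hsink v).1 hb v (mem_univ v)
  refine routableInRounds_of_routing (f := fun _ _ => 0) (P := fun _ _ => []) (fun _ _ => le_rfl)
    (fun s t h => absurd rfl h) (fun s => by simp [hb0]) (fun t => by simp [hb0])
    (fun _ => ⟨0, hK⟩) fun i a => ?_
  simpa [arcLoad] using hc a

end ArcDigraph

end
theorem mainTheorem6 {V A : Type*} [Fintype V] [Fintype A] (D : ArcDigraph V A)
    (b : V → ℝ) (hb : ∑ v, b v = 0) (c : A → ℝ) (hc : ∀ a, 0 ≤ c a)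
    (hfeas : ∃ x : A → ℝ, D.IsTransshipment b x ∧ ∀ a, x a ≤ c a)
    (n : ℕ) (hn : 1 ≤ n)
    (hd : maxDemand b ≤ (1 - 1 / (n : ℝ)) * minCapacity c) :
    D.RoutableInRounds b c ((n + 1) * (groupCount n + 1)) := by
  by_cases hsink : ∃ t, b t < 0
  swap
  · push Not at hsink
    exact ArcDigraph.routableInRounds_of_nonneg hb hc hsink
      (Nat.mul_pos (Nat.succ_pos _) (Nat.succ_pos _))
  have hbd : ∀ t, b t < 0 → -b t ≤ maxDemand b := by
    intro t ht
    rw [← abs_of_neg ht]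
    exact le_ciSup (f := fun t : {v : V // b v < 0} => |b t|) (Set.finite_range _).bddAbove ⟨t, ht⟩
  obtain ⟨t, ht⟩ := hsink
  have hpos : 0 < maxDemand b := (neg_pos.2 ht).trans_le (hbd t ht)
  -- For `n = 1` the hypothesis says that the maximum demand is at most zero, which is impossible if
  -- there is a sink.
  have hn2 : 2 ≤ n := by
    by_contra h
    obtain rfl : n = 1 := by omega
    norm_num at hd
    linarith
  obtain ⟨x, r, hx, hxc, hr⟩ := D.exists_acyclic_transshipment b c hfeas
  refine ArcDigraph.routableInRounds_of_exists_sink hx hxc hr hn2 hpos.le hbd fun a => ?_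
  have hn' : (1 : ℝ) ≤ n := by exact_mod_cast hn
  have h1 : 0 ≤ 1 - 1 / (n : ℝ) := by
    rw [sub_nonneg, div_le_one (by linarith)]
    exact hn'
  exact hd.trans (mul_le_mul_of_nonneg_left (ciInf_le (Set.finite_range c).bddBelow a) h1)
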